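/- Let $k$ be a field of characteristic $p>0$, let $n\ge 0$, and write $\boldsymbol t=(t_1,\dots,t_n)$ and $\boldsymbol t^{\boldsymbol i}=t_1^{i_1}\cdots t_n^{i_n}$ for $\boldsymbol i\in\mathbb Z^n$. Let $G$ be a subgroup of $\mathbb Z^n$ such that $\mathbb Z^n/G$ has no torsion. Let $K_{0,G}$ be the subfield of $k(\boldsymbol t)$ generated by $k$ and the monomials $\boldsymbol t^{\boldsymbol i}$ with $\boldsymbol i\in G$, and for $f=\sum_{\boldsymbol i\in\mathbb N^n}a(\boldsymbol i)\boldsymbol t^{\boldsymbol i}\in k[[\boldsymbol t]]$ define its $G$-diagonal $$\Delta_G(f):=\sum_{\boldsymbol i\in G\cap\mathbb N^n}a(\boldsymbol i)\boldsymbol t^{\boldsymbol i}\in k[[\boldsymbol t]].$$ Let $G_{\mathbb R}$ be the linear subspace of $\mathbb R^n$ spanned by $G$, and let $\pi_G:\mathbb R^{n+1}=\mathbb R^n\times\mathbb R\to(\mathbb R^n/G_{\mathbb R})\times\mathbb R$ be the canonical projection. Let $A(\boldsymbol t,y)\in k[\boldsymbol t,y]$ be a nonzero polynomial and let $f\in k[[\boldsymbol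 t]]$ satisfy $A(\boldsymbol t,f)=0$. Let $\mathrm{NP}(A)\subset\mathbb R^{n+1}$ be the Newton polytope of $A$, that is, the convex hull of the $(\boldsymbol i,j)\in\mathbb N^{n+1}$ such that the coefficient of $\boldsymbol t^{\boldsymbol i}y^j$ in $A$ is nonzero, and set (Minkowski sum) $$C:=\mathrm{NP}(A)+\big(G_{\mathbb R}\times(-1,0]\big)\subset\mathbb R^{n+1}.$$ Then the set $\pi_G(C\cap\mathbb N^{n+1})$ is finite and, putting $N:=\mathrm{Card}\big(\pi_G(C\cap\mathbb N^{n+1})\big)$, there exist $c_0,c_1,\dots,c_N\in K_{0,G}$, not all zero, such that $$c_0\,\Delta_G(f)+c_1\,\Delta_G(f)^p+\cdots+c_N\,\Delta_G(f)^{p^N}=0$$ in the field of fractions of $k[[\boldsymbol t]]$. -/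

import Mathlib

open scoped Pointwise

namespace OreDiagonal

noncomputable section

/-- The polynomial ring `k[t] = k[t_1, …, t_n]`. -/
abbrev Poly (k : Type*) [Field k] (n : ℕ) : Type _ := MvPolynomial (Fin n) k

/-- The ring of formal power series `R = k[[t]] = k[[t_1, …, t_n]]`. -/
abbrev Series (k : Type*) [Field k] (n : ℕ) : Type _ := MvPowerSeries (Fin n) k

/-- The field of rational functions `K₀ = k(t)`. -/
abbrev RatFun (k : Type*) [Field k] (n : ℕ) : Type _ := FractionRing (Poly k n)

/-- The field of fractions `K = Frac(k[[t]])`. -/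
abbrev SeriesField (k : Type*) [Field k] (n : ℕ) : Type _ := FractionRing (Series k n)

theorem poly_to_seriesField_injective (k : Type*) [Field k] (n : ℕ) :
    Function.Injective ((algebraMap (Series k n) (SeriesField k n)).comp
      (MvPolynomial.coeToMvPowerSeries.ringHom : Poly k n →+* Series k n)) := by
  rw [RingHom.coe_comp]
  exact (IsFractionRing.injective (Series k n) (SeriesField k n)).comp
    (MvPolynomial.coe_injective (Fin n) k)

/-- The canonical embedding of `K₀ = k(t)` into `K = Frac(k[[t]])`, extending the inclusion
`k[t] ⊆ k[[t]]`. -/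
def ratFunEmb (k : Type*) [Field k] (n : ℕ) : RatFun k n →+* SeriesField k n :=
  IsFractionRing.lift (poly_to_seriesField_injective k n)

/-- The Laurent monomial `t^i = t_1^{i_1} ⋯ t_n^{i_n}` in `k(t)`, for `i ∈ ℤⁿ`. -/
def laurentMonomial (k : Type*) [Field k] {n : ℕ} (i : Fin n → ℤ) : RatFun k n :=
  ∏ l, (algebraMap (Poly k n) (RatFun k n) (MvPolynomial.X l)) ^ (i l)

/-- The subfield `K_{0,G}` of `k(t)` generated by `k` and the monomials `t^i` with `i ∈ G`. -/
def ratFunG (k : Type*) [Field k] {n : ℕ} (G : AddSubgroup (Fin n → ℤ)) :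
    IntermediateField k (RatFun k n) :=
  IntermediateField.adjoin k {x | ∃ i ∈ G, x = laurentMonomial k i}

/-- The exponent `i ∈ ℕⁿ` seen in `ℤⁿ`. -/
def expInt {n : ℕ} (i : Fin n →₀ ℕ) : Fin n → ℤ := fun l => (i l : ℤ)

theorem expInt_add {n : ℕ} (i j : Fin n →₀ ℕ) : expInt (i + j) = expInt i + expInt j := by
  funext l
  simp [expInt]

theorem expInt_zero {n : ℕ} : expInt (0 : Fin n →₀ ℕ) = 0 := by
  funext l
  simp [expInt]

/-- The `k`-subalgebra `R_G` of `k[[t]]` of the series all of whose exponents lie in `G`. -/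
def seriesG (k : Type*) [Field k] {n : ℕ} (G : AddSubgroup (Fin n → ℤ)) :
    Subalgebra k (Series k n) where
  carrier := {f | ∀ i, expInt i ∉ G → MvPowerSeries.coeff i f = 0}
  mul_mem' := by
    classical
    intro f g hf hg i hi
    rw [MvPowerSeries.coeff_mul]
    refine Finset.sum_eq_zero fun x hx => ?_
    rw [Finset.HasAntidiagonal.mem_antidiagonal] at hx
    by_cases h1 : expInt x.1 ∈ G
    · have h2 : expInt x.2 ∉ G := fun h2 =>
        hi (by rw [← hx, expInt_add]; exact G.add_mem h1 h2)
      rw [hg _ h2, mul_zero]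
    · rw [hf _ h1, zero_mul]
  add_mem' := by
    intro f g hf hg i hi
    rw [map_add, hf i hi, hg i hi, add_zero]
  algebraMap_mem' := by
    classical
    intro r i hi
    rw [MvPowerSeries.algebraMap_apply, MvPowerSeries.coeff_C, if_neg]
    intro h
    exact hi (by rw [h, expInt_zero]; exact G.zero_mem)

open Classical in
/-- The `G`-diagonal `Δ_G : R → R_G`, which keeps the terms of a series whose exponent lies
in `G` and drops the other ones. -/
def gDiagonal (k : Type*) [Field k] {n : ℕ} (G : AddSubgroup (Fin n → ℤ)) :
    Series k n →ₗ[k] seriesG k G where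
  toFun f :=
    ⟨fun i => if expInt i ∈ G then MvPowerSeries.coeff i f else 0, fun _ hi => if_neg hi⟩
  map_add' f g := by
    refine Subtype.ext (MvPowerSeries.ext fun i => ?_)
    change (if expInt i ∈ G then MvPowerSeries.coeff i (f + g) else 0) =
      (if expInt i ∈ G then MvPowerSeries.coeff i f else 0) +
      (if expInt i ∈ G then MvPowerSeries.coeff i g else 0)
    split_ifs <;> simp
  map_smul' r f := by
    refine Subtype.ext (MvPowerSeries.ext fun i => ?_)
    change (if expInt i ∈ G then MvPowerSeries.coeff i (r • f) else 0) =
      r * (if expInt i ∈ G then MvPowerSeries.coeff i f else 0)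
    split_ifs <;> simp

/-- The point of `ℝ^{n+1} = ℝⁿ × ℝ` with coordinates `(i, j) ∈ ℕⁿ × ℕ`. -/
def natPoint {n : ℕ} (i : Fin n → ℕ) (j : ℕ) : (Fin n → ℝ) × ℝ :=
  (fun l => (i l : ℝ), (j : ℝ))

/-- The subset `ℕ^{n+1}` of `ℝ^{n+1} = ℝⁿ × ℝ`. -/
def natPoints (n : ℕ) : Set ((Fin n → ℝ) × ℝ) :=
  {x | ∃ (i : Fin n → ℕ) (j : ℕ), x = natPoint i j}

/-- The Newton polytope of `A ∈ k[t, y] = k[t][y]`: the convex hull in `ℝ^{n+1}` of the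
`(i, j)` such that the coefficient of `t^i y^j` in `A` is nonzero. -/
def newtonPolytope {k : Type*} [Field k] {n : ℕ} (A : Polynomial (Poly k n)) :
    Set ((Fin n → ℝ) × ℝ) :=
  convexHull ℝ {x | ∃ (i : Fin n →₀ ℕ) (j : ℕ),
    MvPolynomial.coeff i (A.coeff j) ≠ 0 ∧ x = natPoint i j}

/-- The real subspace `G_ℝ` of `ℝⁿ` spanned by `G ⊆ ℤⁿ`. -/
def realSpan {n : ℕ} (G : AddSubgroup (Fin n → ℤ)) : Submodule ℝ (Fin n → ℝ) :=
  Submodule.span ℝ {x | ∃ i ∈ G, x = fun l => (i l : ℝ)}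

/-- The canonical projection `π_G : ℝⁿ × ℝ → (ℝⁿ / G_ℝ) × ℝ`. -/
def projG {n : ℕ} (G : AddSubgroup (Fin n → ℤ)) :
    ((Fin n → ℝ) × ℝ) →ₗ[ℝ] (((Fin n → ℝ) ⧸ realSpan G) × ℝ) :=
  LinearMap.prodMap (realSpan G).mkQ LinearMap.id

/-- The convex set `C = NP(A) + (G_ℝ × (-1, 0])`. -/
def convexC {k : Type*} [Field k] {n : ℕ} (G : AddSubgroup (Fin n → ℤ))
    (A : Polynomial (Poly k n)) : Set ((Fin n → ℝ) × ℝ) :=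
  newtonPolytope A + ((realSpan G : Set (Fin n → ℝ)) ×ˢ Set.Ioc (-1 : ℝ) 0)

/-- The set `π_G(C ∩ ℕ^{n+1})`. -/
def classesC {k : Type*} [Field k] {n : ℕ} (G : AddSubgroup (Fin n → ℤ))
    (A : Polynomial (Poly k n)) : Set (((Fin n → ℝ) ⧸ realSpan G) × ℝ) :=
  projG G '' (convexC G A ∩ natPoints n)

end

end OreDiagonal

/-! The argument takes place in the field of Hahn series with exponents in `ℤⁿ` ordered
lexicographically. It contains `Frac(k[[t]])`, and quotients there still have a support that can be
cut down to a subgroup.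

Preparation. Let `S` be the set of coordinates that are positive on some vector of `G ∩ ℕⁿ`. Setting
the other variables to `0` changes neither the diagonal nor algebraicity: the new series `F` is a
root of a nonzero polynomial whose exponents, after a translation, are among those of `A`
(`exists_eval₂_restrictVars_eq_zero`). Let `B` be an irreducible factor vanishing at `F`. A
translate of `NP(B)` lies in `NP(A)`, and `D = B'(F)` is nonzero (`eval₂_derivative_ne_zero`).

Let `Δ` be the projection onto the exponents of `G` supported on `S`. It commutes with monomials
having such exponents and, by torsion-freeness, with the Frobenius (`hahnRestrict_pow_char`).
Consider the `Δ(t^i F^j / D)` with `(i, j)` in the convex set of `B` and `i` supported on `S`. Up to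
a monomial of `K_{0,G}` such an element depends only on the class of `(i, j)`, so their
`K_{0,G}`-span `V` has at most `N` generators (`exists_family_diagonalQuotient`).

Each generator lies in the span of the `p`-th powers of the generators. The residue formula
`cartierEval_mul_pow` writes `F^j / D` as a combination of `p`-th powers `(F^(q-1) / D)^p` with
coefficients taken from `B^(p-1)`. Applying `Δ` to `t^(i+u) (F^(q-1) / D)^p` gives zero, or a
monomial times the `p`-th power of `Δ(t^i' F^(q-1) / D)`, and convexity keeps `(i', q-1)` in the set
(`mem_convexC_of_mul`).

Finally `F = F B'(F) / D` puts `Δ(F)` in `V`. The `N + 1` elements `Δ(F)^(p^j)`, `j ≤ N`, then all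
lie in the span of the `p^N`-th powers of the `N` generators, hence are linearly dependent
(`exists_sum_smul_pow_char_pow_eq_zero`). -/

namespace OreDiagonal

/-! ### Hahn series: projections onto sets of exponents, and the Frobenius. -/

section Hahn

variable {Γ : Type*} [LinearOrder Γ] {k : Type*} [Field k]

open Classical in
/-- Keep the terms of a Hahn series whose exponent lies in `s`. -/
noncomputable def hahnRestrict (s : Set Γ) : HahnSeries Γ k →+ HahnSeries Γ k where
  toFun g := ⟨fun m => if m ∈ s then g.coeff m else 0,
    g.isPWO_support.mono fun m hm => by
      rw [Function.mem_support] at hm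
      exact fun h => hm (by simp [h])⟩
  map_zero' := by ext m; simp
  map_add' x y := by ext m; by_cases h : m ∈ s <;> simp [h]

theorem hahnRestrict_coeff_of_mem {s : Set Γ} {m : Γ} (h : m ∈ s) (g : HahnSeries Γ k) :
    (hahnRestrict s g).coeff m = g.coeff m := if_pos h

theorem hahnRestrict_coeff_of_notMem {s : Set Γ} {m : Γ} (h : m ∉ s) (g : HahnSeries Γ k) :
    (hahnRestrict s g).coeff m = 0 := if_neg h

theorem hahnRestrict_eq_self {s : Set Γ} {g : HahnSeries Γ k} (h : g.support ⊆ s) :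
    hahnRestrict s g = g := by
  ext m
  by_cases hm : m ∈ s
  · exact hahnRestrict_coeff_of_mem hm g
  · rw [hahnRestrict_coeff_of_notMem hm]
    by_contra h0
    exact hm (h (fun h1 => h0 h1.symm))

theorem hahnRestrict_eq_zero {s : Set Γ} {g : HahnSeries Γ k} (h : ∀ m ∈ s, g.coeff m = 0) :
    hahnRestrict s g = 0 := by
  ext m
  by_cases hm : m ∈ s
  · rw [hahnRestrict_coeff_of_mem hm, h m hm, HahnSeries.coeff_zero]
  · rw [hahnRestrict_coeff_of_notMem hm, HahnSeries.coeff_zero]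

theorem support_hahnRestrict_subset (s : Set Γ) (g : HahnSeries Γ k) :
    (hahnRestrict s g).support ⊆ g.support ∩ s := by
  intro m hm
  by_cases h : m ∈ s
  · exact ⟨fun h0 => hm (by rw [hahnRestrict_coeff_of_mem h, h0]), h⟩
  · exact absurd (hahnRestrict_coeff_of_notMem h g) hm

theorem hahnRestrict_add_compl (s : Set Γ) (g : HahnSeries Γ k) :
    hahnRestrict s g + hahnRestrict sᶜ g = g := by
  ext m
  rw [HahnSeries.coeff_add]
  by_cases h : m ∈ s
  · rw [hahnRestrict_coeff_of_mem h, hahnRestrict_coeff_of_notMem (by simpa using h), add_zero]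
  · rw [hahnRestrict_coeff_of_notMem h, hahnRestrict_coeff_of_mem (by simpa using h), zero_add]

theorem hahnRestrict_finset (T : Finset Γ) (g : HahnSeries Γ k) :
    hahnRestrict (T : Set Γ) g = ∑ m ∈ T, HahnSeries.single m (g.coeff m) := by
  classical
  ext m
  rw [HahnSeries.coeff_sum]
  by_cases h : m ∈ T
  · rw [hahnRestrict_coeff_of_mem (by simpa using h), Finset.sum_eq_single m]
    · simp
    · intro b _ hb
      exact HahnSeries.coeff_single_of_ne hb.symm
    · exact fun h' => absurd h h'
  · rw [hahnRestrict_coeff_of_notMem (by simpa using h), Finset.sum_eq_zero]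
    intro b hb
    exact HahnSeries.coeff_single_of_ne fun h' => h (h' ▸ hb)

variable [AddCommGroup Γ] [IsOrderedAddMonoid Γ]

/-- The bound `T` is uniform in `u`: below, `u` is a tail of a series that is itself chosen by means
of `T`. -/
theorem exists_isPWO_support_pow {s : Set Γ} (hs : s.IsPWO) (q : ℕ) :
    ∃ T : Set Γ, T.IsPWO ∧ ∀ u : HahnSeries Γ k, u.support ⊆ s → (u ^ q).support ⊆ T := by
  induction q with
  | zero =>
    refine ⟨(1 : HahnSeries Γ k).support, HahnSeries.isPWO_support _, fun u _ => ?_⟩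
    rw [pow_zero]
  | succ q ih =>
    obtain ⟨T, hT, h⟩ := ih
    refine ⟨T + s, hT.add hs, fun u hu => ?_⟩
    rw [pow_succ]
    exact HahnSeries.support_mul_subset.trans (Set.add_subset_add (h u hu) hu)

instance hahn_charP (p : ℕ) [CharP k p] : CharP (HahnSeries Γ k) p :=
  charP_of_injective_ringHom (f := (HahnSeries.C : k →+* HahnSeries Γ k))
    HahnSeries.C_injective p

/-- The Frobenius is additive only on finite sums, so `g` is truncated. Only finitely many exponents
of `g` can be completed to `e` by an exponent of a `(p-1)`-th power; the tail `u` without them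
contributes nothing to `e`, because `u^p = u * u^(p-1)`. -/
theorem exists_of_coeff_pow_char_ne_zero (p : ℕ) [Fact p.Prime] [CharP k p]
    (g : HahnSeries Γ k) {e : Γ} (he : (g ^ p).coeff e ≠ 0) :
    ∃ m, e = p • m ∧ g.coeff m ≠ 0 := by
  classical
  obtain ⟨T', hT', h⟩ := exists_isPWO_support_pow (k := k) g.isPWO_support (p - 1)
  set T : Finset Γ := (Finset.antidiagonal g.isPWO_support hT' e).image Prod.fst with hT
  have h1 := hahnRestrict_add_compl (T : Set Γ) g
  set u := hahnRestrict (T : Set Γ)ᶜ g with hu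
  have hsupp := support_hahnRestrict_subset (T : Set Γ)ᶜ g
  have hu0 : (u ^ p).coeff e = 0 := by
    have hp : p = (p - 1) + 1 := (Nat.sub_add_cancel (Fact.out : p.Prime).one_le).symm
    rw [hp, pow_succ']
    by_contra hne
    obtain ⟨a, ha, b, hb, hab⟩ := HahnSeries.support_mul_subset (show e ∈ _ from hne)
    have ha' := hsupp ha
    refine ha'.2 ?_
    rw [hT, Finset.coe_image]
    refine ⟨(a, b), ?_, rfl⟩
    rw [Finset.mem_coe, Finset.mem_antidiagonal]
    exact ⟨ha'.1, h u (fun x hx => (hsupp hx).1) hb, hab⟩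
  rw [← h1, add_pow_char, HahnSeries.coeff_add, hu0, add_zero, hahnRestrict_finset,
    sum_pow_char, HahnSeries.coeff_sum] at he
  obtain ⟨m, hm, hne⟩ := Finset.exists_ne_zero_of_sum_ne_zero he
  rw [HahnSeries.single_pow] at hne
  refine ⟨m, ?_, ?_⟩
  · by_contra h'
    exact hne (HahnSeries.coeff_single_of_ne h')
  · rw [hT, Finset.mem_image] at hm
    obtain ⟨x, hx, rfl⟩ := hm
    exact (Finset.mem_antidiagonal.1 hx).1

theorem support_pow_subset_addSubgroup (G : AddSubgroup Γ) {u : HahnSeries Γ k}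
    (hu : u.support ⊆ G) (q : ℕ) : (u ^ q).support ⊆ G := by
  induction q with
  | zero =>
    rw [pow_zero]
    intro m hm
    rw [HahnSeries.mem_support, HahnSeries.coeff_one] at hm
    by_cases h : m = 0
    · exact h ▸ G.zero_mem
    · exact absurd (if_neg h) hm
  | succ q ih =>
    rw [pow_succ]
    refine HahnSeries.support_mul_subset.trans ?_
    rintro _ ⟨a, ha, b, hb, rfl⟩
    exact G.add_mem (ih ha) (hu hb)

theorem hahnRestrict_single_mul (G : AddSubgroup Γ) {i : Γ} (hi : i ∈ G) (r : k)
    (g : HahnSeries Γ k) : hahnRestrict (G : Set Γ) (HahnSeries.single i r * g) =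
      HahnSeries.single i r * hahnRestrict (G : Set Γ) g := by
  ext m
  rw [HahnSeries.coeff_single_mul]
  by_cases h : m ∈ G
  · rw [hahnRestrict_coeff_of_mem h, hahnRestrict_coeff_of_mem (G.sub_mem h hi),
      HahnSeries.coeff_single_mul]
  · rw [hahnRestrict_coeff_of_notMem h, hahnRestrict_coeff_of_notMem, mul_zero]
    intro h'
    exact h (by simpa using G.add_mem h' hi)

/-- Split `g` into its parts on and off `G`. The exponents of the `p`-th power of the second part
are `p • m` with `m ∉ G`, so `hG` keeps them off `G`. -/
theorem hahnRestrict_pow_char (p : ℕ) [Fact p.Prime] [CharP k p] (G : AddSubgroup Γ)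
    (hG : ∀ m, p • m ∈ G → m ∈ G) (g : HahnSeries Γ k) :
    hahnRestrict (G : Set Γ) (g ^ p) = hahnRestrict (G : Set Γ) g ^ p := by
  conv_lhs => rw [← hahnRestrict_add_compl (G : Set Γ) g, add_pow_char, map_add]
  have h1 : hahnRestrict (G : Set Γ) (hahnRestrict (G : Set Γ)ᶜ g ^ p) = 0 := by
    refine hahnRestrict_eq_zero fun e he => ?_
    by_contra hne
    obtain ⟨m, rfl, hm⟩ := exists_of_coeff_pow_char_ne_zero p _ hne
    exact hm (hahnRestrict_coeff_of_notMem (by simpa using hG m he) g)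
  rw [h1, add_zero]
  exact hahnRestrict_eq_self (support_pow_subset_addSubgroup G
    (fun m hm => (support_hahnRestrict_subset _ _ hm).2) p)

/-- The diagonal of `t^i g^p` vanishes unless `i ∈ G + p Γ`. -/
theorem hahnRestrict_single_mul_pow_char (p : ℕ) [Fact p.Prime] [CharP k p] (G : AddSubgroup Γ)
    (hG : ∀ m, p • m ∈ G → m ∈ G) (i : Γ) (g : HahnSeries Γ k) :
    hahnRestrict (G : Set Γ) (HahnSeries.single i 1 * g ^ p) = 0 ∨
    ∃ γ ∈ G, ∃ i', i = γ + p • i' ∧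
      hahnRestrict (G : Set Γ) (HahnSeries.single i 1 * g ^ p) =
        HahnSeries.single γ 1 *
          hahnRestrict (G : Set Γ) (HahnSeries.single i' 1 * g) ^ p := by
  by_cases h : ∃ γ ∈ G, ∃ i', i = γ + p • i'
  · obtain ⟨γ, hγ, i', rfl⟩ := h
    refine Or.inr ⟨γ, hγ, i', rfl, ?_⟩
    rw [← hahnRestrict_pow_char p G hG, ← hahnRestrict_single_mul G hγ, mul_pow,
      HahnSeries.single_pow, one_pow, ← mul_assoc, HahnSeries.single_mul_single, one_mul]
  · refine Or.inl (hahnRestrict_eq_zero fun e he => ?_)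
    by_contra hne
    rw [HahnSeries.coeff_single_mul, one_mul] at hne
    obtain ⟨m, hm, -⟩ := exists_of_coeff_pow_char_ne_zero p g hne
    refine h ⟨e, he, -m, ?_⟩
    rw [smul_neg, ← hm]
    abel

end Hahn

/-! ### The residue formula for the Cartier operator. -/

section Cartier

open Polynomial

variable {H : Type*} [CommRing H]

/-- The linear form `∑ a_m y^m ↦ ∑_j a_{pj+p-1} x^{pj}`. -/
noncomputable def cartierEval (p : ℕ) (x : H) : H[X] →ₗ[H] H :=
  Polynomial.lsum fun m => if p ∣ m + 1 then (LinearMap.mulRight H (x ^ (m + 1 - p))) else 0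

theorem cartierEval_monomial (p : ℕ) (x : H) (m : ℕ) (c : H) :
    cartierEval p x (monomial m c) = if p ∣ m + 1 then c * x ^ (m + 1 - p) else 0 := by
  rw [cartierEval, Polynomial.lsum_apply, Polynomial.sum_monomial_index] <;>
    split_ifs <;> simp

theorem cartierEval_apply (p : ℕ) (x : H) (F : H[X]) :
    cartierEval p x F =
      ∑ m ∈ F.support, if p ∣ m + 1 then F.coeff m * x ^ (m + 1 - p) else 0 := by
  rw [cartierEval, Polynomial.lsum_apply, Polynomial.sum]
  refine Finset.sum_congr rfl fun m _ => ?_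
  split_ifs <;> simp

theorem cartierEval_X_pow_mul {p : ℕ} (x : H) (F : H[X]) :
    cartierEval p x (X ^ p * F) = x ^ p * cartierEval p x F := by
  induction F using Polynomial.induction_on' with
  | add f g hf hg => rw [mul_add, map_add, hf, hg, map_add, mul_add]
  | monomial m c =>
    rw [X_pow_mul_monomial, cartierEval_monomial, cartierEval_monomial]
    have h1 : p ∣ m + p + 1 ↔ p ∣ m + 1 := by
      rw [show m + p + 1 = m + 1 + p by ring]
      exact Nat.dvd_add_self_right
    by_cases h : p ∣ m + 1
    · rw [if_pos (h1.2 h), if_pos h]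
      have := Nat.le_of_dvd (Nat.succ_pos m) h
      rw [show m + p + 1 - p = p + (m + 1 - p) by omega, pow_add]
      ring
    · rw [if_neg (fun h' => h (h1.1 h')), if_neg h, mul_zero]

/-- Write `P = P(x) + (y - x) R`. The second term yields `(y^p - x^p) R`, which the form kills
because it turns the factor `y^p` into `x^p`. The first yields `P(x)` times a monic polynomial of
degree `p - 1`, of which only the leading term is seen. -/
theorem cartierEval_mul_sub_pow (p : ℕ) [hp : Fact p.Prime] [CharP H p] (x : H) (P : H[X]) :
    cartierEval p x (P * (X - C x) ^ (p - 1)) = P.eval x := by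
  nontriviality H
  have hp1 := hp.out.one_lt
  obtain ⟨R, hR⟩ : X - C x ∣ P - C (P.eval x) := by
    rw [dvd_iff_isRoot]; simp
  have hP : P = C (P.eval x) + (X - C x) * R := by rw [← hR]; ring
  have h1 : P * (X - C x) ^ (p - 1) =
      P.eval x • (X - C x) ^ (p - 1) + (X ^ p * R - x ^ p • R) := by
    conv_lhs => rw [hP]
    have : (X - C x) ^ p = X ^ p - C (x ^ p) := by rw [sub_pow_char, C_pow]
    rw [add_mul, smul_eq_C_mul, smul_eq_C_mul, ← sub_mul, ← this]
    conv_rhs => rw [← Nat.sub_add_cancel hp1.le, pow_succ]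
    simp only [Nat.add_sub_cancel]
    ring
  rw [h1, map_add, map_sub, cartierEval_X_pow_mul, map_smul, map_smul, smul_eq_mul, smul_eq_mul,
    sub_self, add_zero, cartierEval_apply]
  have hdeg : ((X - C x) ^ (p - 1)).natDegree = p - 1 := by
    rw [(monic_X_sub_C x).natDegree_pow, natDegree_X_sub_C, mul_one]
  rw [Finset.sum_eq_single (p - 1)]
  · rw [if_pos (by rw [Nat.sub_add_cancel hp1.le]), Nat.sub_add_cancel hp1.le, Nat.sub_self,
      pow_zero, mul_one]
    have := ((monic_X_sub_C x).pow (p - 1)).coeff_natDegree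
    rw [hdeg] at this
    rw [this, mul_one]
  · intro m hm hne
    refine if_neg fun hd => hne ?_
    have h2 := le_natDegree_of_mem_supp m hm
    rw [hdeg] at h2
    have := Nat.le_of_dvd (Nat.succ_pos m) hd
    omega
  · intro h
    rw [if_pos (by rw [Nat.sub_add_cancel hp1.le]), notMem_support_iff.1 h, zero_mul]

/-- Residue form of the Cartier operator: if `B(x) = 0` then
`P(x) B'(x)^{p-1} = ∑_j [y^{pj+p-1}](P B^{p-1}) x^{pj}`. -/
theorem cartierEval_mul_pow (p : ℕ) [hp : Fact p.Prime] [CharP H p] (x : H) (P B : H[X])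
    (hB : B.eval x = 0) :
    cartierEval p x (P * B ^ (p - 1)) = P.eval x * (derivative B).eval x ^ (p - 1) := by
  obtain ⟨R, rfl⟩ := dvd_iff_isRoot.2 hB
  rw [mul_pow, show P * ((X - C x) ^ (p - 1) * R ^ (p - 1)) =
    P * R ^ (p - 1) * (X - C x) ^ (p - 1) by ring, cartierEval_mul_sub_pow]
  simp

end Cartier

/-! ### Additive polynomials from a span stable under the Frobenius. -/

section LinearAlgebra

variable {F H : Type*} [Field F] [CommRing H] [Algebra F H]

theorem pow_mem_span_pow (p : ℕ) [Fact p.Prime] [CharP H p] {ι : Type*} {x : ι → H} {w : H}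
    (hw : w ∈ Submodule.span F (Set.range x)) :
    w ^ p ∈ Submodule.span F (Set.range fun i => x i ^ p) := by
  induction hw using Submodule.span_induction with
  | mem y hy =>
    obtain ⟨i, rfl⟩ := hy
    exact Submodule.subset_span ⟨i, rfl⟩
  | zero => rw [zero_pow (Fact.out : p.Prime).ne_zero]; exact Submodule.zero_mem _
  | add y z _ _ hy hz => rw [add_pow_char]; exact Submodule.add_mem _ hy hz
  | smul a y _ hy => rw [smul_pow]; exact Submodule.smul_mem _ _ hy

theorem pow_pow_mem_span_pow_pow (p : ℕ) [Fact p.Prime] [CharP H p] {ι : Type*} {x : ι → H} {w : H}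
    (hw : w ∈ Submodule.span F (Set.range x)) (s : ℕ) :
    w ^ p ^ s ∈ Submodule.span F (Set.range fun i => x i ^ p ^ s) := by
  induction s with
  | zero => simpa using hw
  | succ s ih => simpa only [pow_succ, pow_mul] using pow_mem_span_pow p ih

/-- If a family of `N` elements lies in the span of its `p`-th powers, then every element of its
span is annihilated by a nonzero additive polynomial of height at most `N`. -/
theorem exists_sum_smul_pow_char_pow_eq_zero (p : ℕ) [Fact p.Prime] [CharP H p]
    {ι : Type*} [Fintype ι]
    {x : ι → H} (hx : ∀ i, x i ∈ Submodule.span F (Set.range fun i => x i ^ p)) {w : H}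
    (hw : w ∈ Submodule.span F (Set.range x)) :
    ∃ c : Fin (Fintype.card ι + 1) → F, (∃ j, c j ≠ 0) ∧
      ∑ j, c j • w ^ p ^ (j : ℕ) = 0 := by
  -- These spans increase with `s`, while the number of generators stays fixed; the last one
  -- contains all the required powers of `w`.
  set V : ℕ → Submodule F H := fun s => Submodule.span F (Set.range fun i => x i ^ p ^ s) with hV
  have hstep : ∀ s, V s ≤ V (s + 1) := by
    intro s
    rw [hV]
    refine Submodule.span_le.2 ?_
    rintro _ ⟨i, rfl⟩
    have := pow_pow_mem_span_pow_pow p (hx i) s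
    simp only [← pow_mul, ← pow_succ'] at this
    exact this
  have hmono : Monotone V := monotone_nat_of_le_succ hstep
  have hmem : ∀ j : Fin (Fintype.card ι + 1), w ^ p ^ (j : ℕ) ∈ V (Fintype.card ι) := fun j =>
    hmono (Nat.lt_succ_iff.1 j.2) (pow_pow_mem_span_pow_pow p hw j)
  have hfin : Module.finrank F (V (Fintype.card ι)) ≤ Fintype.card ι := finrank_range_le_card _
  have : Module.Finite F (V (Fintype.card ι)) := FiniteDimensional.span_of_finite F
    (Set.finite_range _)
  have hdep : ¬ LinearIndependent F
      (fun j => (⟨_, hmem j⟩ : V (Fintype.card ι))) := by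
    intro h
    have := h.fintype_card_le_finrank
    rw [Fintype.card_fin] at this
    omega
  obtain ⟨c, hc, j, hj⟩ := Fintype.not_linearIndependent_iff.1 hdep
  refine ⟨c, ⟨j, hj⟩, ?_⟩
  have := congrArg Subtype.val hc
  simpa using this

end LinearAlgebra

/-! ### Embedding power series and rational functions into Hahn series. -/

section Embedding

variable {n : ℕ}

theorem expInt_injective : Function.Injective (expInt : (Fin n →₀ ℕ) → Fin n → ℤ) := by
  intro i j h
  ext l
  have := congrFun h l
  simpa [expInt] using this

/-- The exponent `i ∈ ℕⁿ` in `ℤⁿ` ordered lexicographically. -/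
def expLex (i : Fin n →₀ ℕ) : Lex (Fin n → ℤ) := toLex (expInt i)

theorem expLex_injective : Function.Injective (expLex : (Fin n →₀ ℕ) → Lex (Fin n → ℤ)) :=
  toLex.injective.comp expInt_injective

theorem expLex_add (i j : Fin n →₀ ℕ) : expLex (i + j) = expLex i + expLex j := by
  rw [expLex, expInt_add]; rfl

theorem expLex_zero : expLex (0 : Fin n →₀ ℕ) = 0 := by
  rw [expLex, expInt_zero]; rfl

theorem expLex_monotone : Monotone (expLex : (Fin n →₀ ℕ) → Lex (Fin n → ℤ)) := by
  intro i j h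
  refine Pi.toLex_monotone fun l => ?_
  have := h l
  simpa [expInt] using this

/-- Dickson's lemma, transported along the monotone map from the product order to the lexicographic
one. -/
theorem isPWO_range_expLex : (Set.range (expLex : (Fin n →₀ ℕ) → Lex (Fin n → ℤ))).IsPWO := by
  rw [← Set.image_univ]
  exact (Set.isPWO_of_wellQuasiOrderedLE Set.univ).image_of_monotone expLex_monotone

/-- The field of Hahn series with exponents in `ℤⁿ` ordered lexicographically. -/
abbrev LexSeries (k : Type*) [Field k] (n : ℕ) : Type _ := HahnSeries (Lex (Fin n → ℤ)) k

variable {k : Type*} [Field k]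

/-- A power series seen as a Hahn series. -/
noncomputable def seriesToLex (g : Series k n) : LexSeries k n :=
  ⟨Function.extend expLex (fun i => MvPowerSeries.coeff i g) 0,
    isPWO_range_expLex.mono fun m hm => by
      by_contra h
      exact hm (Function.extend_apply' _ _ _ h)⟩

theorem seriesToLex_coeff_expLex (g : Series k n) (i : Fin n →₀ ℕ) :
    (seriesToLex g).coeff (expLex i) = MvPowerSeries.coeff i g :=
  expLex_injective.extend_apply _ _ i

theorem seriesToLex_coeff_of_notMem (g : Series k n) {m : Lex (Fin n → ℤ)}
    (h : m ∉ Set.range expLex) : (seriesToLex g).coeff m = 0 :=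
  Function.extend_apply' _ _ _ h

theorem seriesToLex_monomial (i : Fin n →₀ ℕ) (c : k) :
    seriesToLex (MvPowerSeries.monomial i c) = HahnSeries.single (expLex i) c := by
  classical
  ext m
  by_cases hm : m ∈ Set.range expLex
  · obtain ⟨j, rfl⟩ := hm
    rw [seriesToLex_coeff_expLex, MvPowerSeries.coeff_monomial]
    split_ifs with h
    · rw [h, HahnSeries.coeff_single_same]
    · rw [HahnSeries.coeff_single_of_ne fun h' => h (expLex_injective h')]
  · rw [seriesToLex_coeff_of_notMem _ hm, HahnSeries.coeff_single_of_ne]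
    rintro rfl
    exact hm ⟨i, rfl⟩

theorem seriesToLex_mul (g h : Series k n) :
    seriesToLex (g * h) = seriesToLex g * seriesToLex h := by
  classical
  have hsupp : ∀ g : Series k n, ∀ m ∈ (seriesToLex g).support, m ∈ Set.range expLex := by
    intro g m hm
    by_contra h'
    exact hm (seriesToLex_coeff_of_notMem g h')
  ext m
  rw [HahnSeries.coeff_mul]
  by_cases hm : m ∈ Set.range expLex
  · obtain ⟨i, rfl⟩ := hm
    rw [seriesToLex_coeff_expLex, MvPowerSeries.coeff_mul]
    have h1 : ∑ x ∈ Finset.HasAntidiagonal.antidiagonal i,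
        MvPowerSeries.coeff x.1 g * MvPowerSeries.coeff x.2 h =
        ∑ x ∈ (Finset.HasAntidiagonal.antidiagonal i).image (Prod.map expLex expLex),
          (seriesToLex g).coeff x.1 * (seriesToLex h).coeff x.2 := by
      rw [Finset.sum_image fun x _ y _ hxy =>
        (expLex_injective.prodMap expLex_injective) hxy]
      refine Finset.sum_congr rfl fun x _ => ?_
      simp only [Prod.map_fst, Prod.map_snd, seriesToLex_coeff_expLex]
    rw [h1]
    symm
    refine Finset.sum_subset ?_ ?_
    · rintro ⟨a, b⟩ hx
      rw [Finset.mem_antidiagonal] at hx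
      obtain ⟨ha, hb, hab⟩ := hx
      obtain ⟨a, rfl⟩ := hsupp g a ha
      obtain ⟨b, rfl⟩ := hsupp h b hb
      refine Finset.mem_image.2 ⟨(a, b), ?_, rfl⟩
      rw [Finset.HasAntidiagonal.mem_antidiagonal]
      exact expLex_injective (by rw [expLex_add]; exact hab)
    · rintro ⟨a, b⟩ hx hnot
      obtain ⟨y, hy, hxy⟩ := Finset.mem_image.1 hx
      rw [Finset.HasAntidiagonal.mem_antidiagonal] at hy
      by_contra hne
      refine hnot (Finset.mem_antidiagonal.2 ⟨left_ne_zero_of_mul hne,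
        right_ne_zero_of_mul hne, ?_⟩)
      rw [← hxy, ← hy]
      exact (expLex_add _ _).symm
  · rw [seriesToLex_coeff_of_notMem _ hm, Finset.sum_eq_zero]
    rintro ⟨a, b⟩ hx
    rw [Finset.mem_antidiagonal] at hx
    obtain ⟨ha, hb, hab⟩ := hx
    obtain ⟨a, rfl⟩ := hsupp g a ha
    obtain ⟨b, rfl⟩ := hsupp h b hb
    exact absurd ⟨a + b, by rw [expLex_add]; exact hab⟩ hm

/-- The embedding of `k[[t]]` into the field of Hahn series. -/
noncomputable def seriesEmb (k : Type*) [Field k] (n : ℕ) : Series k n →+* LexSeries k n where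
  toFun := seriesToLex
  map_one' := by
    rw [← MvPowerSeries.monomial_zero_one, seriesToLex_monomial, expLex_zero]; rfl
  map_mul' := seriesToLex_mul
  map_zero' := by
    ext m
    by_cases hm : m ∈ Set.range expLex
    · obtain ⟨i, rfl⟩ := hm
      rw [seriesToLex_coeff_expLex, map_zero, HahnSeries.coeff_zero]
    · rw [seriesToLex_coeff_of_notMem _ hm, HahnSeries.coeff_zero]
  map_add' g h := by
    ext m
    rw [HahnSeries.coeff_add]
    by_cases hm : m ∈ Set.range expLex
    · obtain ⟨i, rfl⟩ := hm
      simp only [seriesToLex_coeff_expLex, map_add]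
    · simp only [seriesToLex_coeff_of_notMem _ hm, add_zero]

theorem seriesEmb_coeff_expLex (g : Series k n) (i : Fin n →₀ ℕ) :
    (seriesEmb k n g).coeff (expLex i) = MvPowerSeries.coeff i g := seriesToLex_coeff_expLex g i

theorem seriesEmb_coeff_of_notMem (g : Series k n) {m : Lex (Fin n → ℤ)}
    (h : m ∉ Set.range expLex) : (seriesEmb k n g).coeff m = 0 :=
  seriesToLex_coeff_of_notMem g h

theorem seriesEmb_monomial (i : Fin n →₀ ℕ) (c : k) :
    seriesEmb k n (MvPowerSeries.monomial i c) = HahnSeries.single (expLex i) c :=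
  seriesToLex_monomial i c

theorem seriesEmb_injective : Function.Injective (seriesEmb k n) := by
  intro g h hgh
  ext i
  rw [← seriesEmb_coeff_expLex, hgh, seriesEmb_coeff_expLex]

/-- The embedding of `Frac(k[[t]])` into the field of Hahn series. -/
noncomputable def seriesFieldEmb (k : Type*) [Field k] (n : ℕ) :
    SeriesField k n →+* LexSeries k n :=
  IsFractionRing.lift (seriesEmb_injective (k := k) (n := n))

theorem seriesFieldEmb_algebraMap (g : Series k n) :
    seriesFieldEmb k n (algebraMap (Series k n) (SeriesField k n) g) = seriesEmb k n g :=
  IsFractionRing.lift_algebraMap _ g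

/-- The embedding of `k(t)` into the field of Hahn series. -/
noncomputable def ratFunToLex (k : Type*) [Field k] (n : ℕ) : RatFun k n →+* LexSeries k n :=
  (seriesFieldEmb k n).comp (ratFunEmb k n)

theorem ratFunToLex_algebraMap (a : Poly k n) :
    ratFunToLex k n (algebraMap (Poly k n) (RatFun k n) a) =
      seriesEmb k n (MvPolynomial.coeToMvPowerSeries.ringHom a) := by
  rw [ratFunToLex, RingHom.comp_apply, ratFunEmb, IsFractionRing.lift_algebraMap,
    RingHom.comp_apply, seriesFieldEmb_algebraMap]

theorem ratFunToLex_algebraMap_const (a : k) :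
    ratFunToLex k n (algebraMap k (RatFun k n) a) = HahnSeries.single 0 a := by
  rw [IsScalarTower.algebraMap_apply k (Poly k n) (RatFun k n), ratFunToLex_algebraMap,
    ← expLex_zero, ← seriesEmb_monomial]
  congr 1
  rw [MvPolynomial.algebraMap_eq]
  simp

theorem single_zpow {Γ : Type*} [AddCommGroup Γ] [LinearOrder Γ] [IsOrderedAddMonoid Γ]
    (m : Γ) (z : ℤ) :
    (HahnSeries.single m (1 : k)) ^ z = HahnSeries.single (z • m) 1 := by
  obtain ⟨q, rfl | rfl⟩ := z.eq_nat_or_neg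
  · rw [zpow_natCast, HahnSeries.single_pow, one_pow, natCast_zsmul]
  · rw [zpow_neg, zpow_natCast, HahnSeries.single_pow, one_pow, neg_smul, natCast_zsmul,
      HahnSeries.inv_single, inv_one]

theorem prod_single {Γ : Type*} [AddCommGroup Γ] [LinearOrder Γ] [IsOrderedAddMonoid Γ]
    {ι : Type*} (s : Finset ι) (m : ι → Γ) :
    ∏ l ∈ s, HahnSeries.single (m l) (1 : k) = HahnSeries.single (∑ l ∈ s, m l) 1 := by
  classical
  induction s using Finset.induction_on with
  | empty => rw [Finset.prod_empty, Finset.sum_empty]; rfl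
  | insert a s ha ih =>
    rw [Finset.prod_insert ha, Finset.sum_insert ha, ih, HahnSeries.single_mul_single, one_mul]

theorem ratFunToLex_laurentMonomial (i : Fin n → ℤ) :
    ratFunToLex k n (laurentMonomial k i) = HahnSeries.single (toLex i) 1 := by
  classical
  have h1 : ∀ l : Fin n, ratFunToLex k n (algebraMap (Poly k n) (RatFun k n) (MvPolynomial.X l)) =
      HahnSeries.single (toLex (Pi.single l 1)) 1 := by
    intro l
    rw [ratFunToLex_algebraMap]
    have : MvPolynomial.coeToMvPowerSeries.ringHom (MvPolynomial.X l : Poly k n) =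
        MvPowerSeries.monomial (Finsupp.single l 1) 1 := by
      simp [MvPowerSeries.X]
    rw [this, seriesEmb_monomial, expLex]
    congr 2
    funext j
    by_cases h : j = l
    · subst h; simp [expInt]
    · simp [expInt, h]
  rw [laurentMonomial, map_prod]
  simp only [map_zpow₀, h1, single_zpow]
  rw [prod_single]
  congr 1
  have : ∑ l, i l • (Pi.single l 1 : Fin n → ℤ) = i := by
    funext j
    simp [Finset.sum_apply, Pi.single_apply]
  conv_rhs => rw [← this]
  rfl

theorem gDiagonal_coeff (G : AddSubgroup (Fin n → ℤ)) (f : Series k n) (i : Fin n →₀ ℕ)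
    [Decidable (expInt i ∈ G)] :
    MvPowerSeries.coeff i (gDiagonal k G f : Series k n) =
      if expInt i ∈ G then MvPowerSeries.coeff i f else 0 := by
  by_cases h : expInt i ∈ G
  · rw [if_pos h]; exact if_pos h
  · rw [if_neg h]; exact if_neg h

end Embedding

/-! ### Separability of algebraic power series. -/

section Separability

open Polynomial

theorem exists_irreducible_factor_of_map_eq_zero {R D : Type*} [CommRing R] [IsDomain R]
    [WfDvdMonoid R] [CommRing D] [IsDomain D] (φ : R →+* D) {a : R} (ha : a ≠ 0)
    (h : φ a = 0) : ∃ b q, a = b * q ∧ Irreducible b ∧ φ b = 0 := by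
  induction a using WfDvdMonoid.induction_on_irreducible with
  | zero => exact absurd rfl ha
  | unit u hu => exact absurd h (hu.map φ).ne_zero
  | mul a i ha' hi ih =>
    rw [map_mul, mul_eq_zero] at h
    rcases h with h | h
    · exact ⟨i, a, rfl, hi, h⟩
    · obtain ⟨b, q, rfl, hb, hb'⟩ := ih ha' h
      exact ⟨b, i * q, by ring, hb, hb'⟩

/-- Gauss' lemma: an irreducible polynomial has minimal degree among the polynomials that vanish
at one of its roots. -/
theorem eval₂_ne_zero_of_natDegree_lt {R D : Type*} [CommRing R] [IsDomain R] [IsGCDMonoid R]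
    [Field D] {φ : R →+* D} (hφ : Function.Injective φ) {x : D} {B P : R[X]}
    (hB : Irreducible B) (hx : B.eval₂ φ x = 0) (hP : P ≠ 0) (hdeg : P.natDegree < B.natDegree) :
    P.eval₂ φ x ≠ 0 := by
  intro hPx
  have hinj := IsFractionRing.injective R (FractionRing R)
  have hirr : Irreducible (B.map (algebraMap R (FractionRing R))) :=
    ((hB.isPrimitive (by omega)).irreducible_iff_irreducible_map_fraction_map).1 hB
  -- Over the fraction field, a Bézout relation evaluated at a common root would read `0 = 1`.
  have hcop : IsCoprime (B.map (algebraMap R (FractionRing R)))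
      (P.map (algebraMap R (FractionRing R))) := by
    rw [hirr.coprime_iff_not_dvd]
    intro hd
    have h1 := natDegree_le_of_dvd hd ((Polynomial.map_ne_zero_iff hinj).2 hP)
    rw [natDegree_map_eq_of_injective hinj, natDegree_map_eq_of_injective hinj] at h1
    omega
  obtain ⟨u, v, huv⟩ := hcop
  have hev : ∀ Q : R[X], (Q.map (algebraMap R (FractionRing R))).eval₂ (IsFractionRing.lift hφ) x =
      Q.eval₂ φ x := by
    intro Q
    rw [eval₂_map]
    congr 1
    ext r
    exact IsFractionRing.lift_algebraMap hφ r
  have := congrArg (eval₂ (IsFractionRing.lift hφ) x) huv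
  rw [eval₂_add, eval₂_mul, eval₂_mul, hev, hev, hx, hPx, mul_zero, mul_zero, add_zero,
    eval₂_one] at this
  exact zero_ne_one this

variable {k : Type*} [Field k] {n : ℕ}

theorem exists_mvPolynomial_polynomial_coeff (F : (Fin n →₀ ℕ) → ℕ → k)
    (hF : {x : (Fin n →₀ ℕ) × ℕ | F x.1 x.2 ≠ 0}.Finite) :
    ∃ P : (Poly k n)[X], ∀ i j, MvPolynomial.coeff i (P.coeff j) = F i j := by
  classical
  refine ⟨∑ x ∈ hF.toFinset, monomial x.2 (MvPolynomial.monomial x.1 (F x.1 x.2)), fun i j => ?_⟩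
  rw [finsetSum_coeff, MvPolynomial.coeff_sum]
  have h : ∀ x : (Fin n →₀ ℕ) × ℕ, MvPolynomial.coeff i
      ((monomial x.2 (MvPolynomial.monomial x.1 (F x.1 x.2))).coeff j) =
      if x = (i, j) then F i j else 0 := by
    rintro ⟨i', j'⟩
    rw [coeff_monomial]
    by_cases hj : j' = j
    · subst hj
      rw [if_pos rfl, MvPolynomial.coeff_monomial]
      by_cases hi : i' = i
      · subst hi; simp
      · simp [hi]
    · simp [hj]
  simp only [h, Finset.sum_ite_eq', Set.Finite.mem_toFinset, Set.mem_ofPred_eq]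
  split_ifs with h0
  · rfl
  · exact (not_not.1 h0).symm

theorem finite_setOf_coeff_ne_zero (A : (Poly k n)[X]) :
    {x : (Fin n →₀ ℕ) × ℕ | MvPolynomial.coeff x.1 (A.coeff x.2) ≠ 0}.Finite := by
  classical
  refine (A.support.biUnion fun j => (A.coeff j).support.image fun i => (i, j)).finite_toSet.subset ?_
  rintro ⟨i, j⟩ h
  simp only [Finset.coe_biUnion, Set.mem_iUnion, Finset.coe_image]
  refine ⟨j, ?_, i, ?_, rfl⟩
  · rw [Finset.mem_coe, mem_support_iff]
    intro h0
    exact h (by simp [h0])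
  · rw [Finset.mem_coe, MvPolynomial.mem_support_iff]
    exact h

theorem exists_coeff_coeff_ne_zero {A : (Poly k n)[X]} (hA : A ≠ 0) :
    ∃ i j, MvPolynomial.coeff i (A.coeff j) ≠ 0 := by
  by_contra! h
  refine hA ?_
  ext j i
  simpa using h i j

theorem exists_addMonoidHom_ne_zero {V : Type*} [AddCommGroup V] [Module k V] {v : V}
    (hv : v ≠ 0) : ∃ φ : V →+ k, (∀ (b : k) (w : V), φ (b • w) = b * φ w) ∧ φ v ≠ 0 := by
  have h := (Module.forall_dual_apply_eq_zero_iff k v).not.2 hv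
  push Not at h
  obtain ⟨φ, hφ⟩ := h
  exact ⟨φ.toAddMonoidHom, fun b w => φ.map_smul b w, hφ⟩

/-- A linear form on `k` seen as a vector space over itself through the Frobenius. It replaces the
`p`-th root, which need not exist when `k` is imperfect. -/
theorem exists_frobenius_semilinear_ne_zero (p : ℕ) [Fact p.Prime] [CharP k p] {c : k}
    (hc : c ≠ 0) : ∃ φ : k →+ k, (∀ a b, φ (a * b ^ p) = φ a * b) ∧ φ c ≠ 0 := by
  obtain ⟨φ, hφ, hφc⟩ := @exists_addMonoidHom_ne_zero k _ k _
    (Module.compHom k (frobenius k p)) c hc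
  refine ⟨φ, fun a b => ?_, hφc⟩
  rw [mul_comm a, mul_comm (φ a)]
  exact hφ b a

/-- The section operator `∑ a_i t^i ↦ ∑ φ(a_{pm+r}) t^m`. -/
noncomputable def cartierSection (φ : k →+ k) (p : ℕ) (r : Fin n →₀ ℕ) : Series k n →+ Series k n where
  toFun h := fun m => φ (MvPowerSeries.coeff (p • m + r) h)
  map_zero' := by funext m; simp; rfl
  map_add' g h := by funext m; simp; rfl

theorem coeff_cartierSection (φ : k →+ k) (p : ℕ) (r m : Fin n →₀ ℕ) (h : Series k n) :
    MvPowerSeries.coeff m (cartierSection φ p r h) = φ (MvPowerSeries.coeff (p • m + r) h) := rfl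

/-- The series `g^p` has exponents `p • v` and coefficients that are `p`-th powers, so `φ` extracts
the coefficients of `g`. Since `r l < p`, the equation `u + p • v = p • m + r` forces `v ≤ m`, so no
term of the convolution is missed. -/
theorem cartierSection_mul_pow (p : ℕ) [hp : Fact p.Prime] [CharP k p] {φ : k →+ k}
    (hφ : ∀ a b, φ (a * b ^ p) = φ a * b) {r : Fin n →₀ ℕ} (hr : ∀ l, r l < p)
    (h g : Series k n) : cartierSection φ p r (h * g ^ p) = cartierSection φ p r h * g := by
  classical
  have hp0 := hp.out.ne_zero
  have hg1 : ∀ v, MvPowerSeries.coeff (p • v) (g ^ p) = MvPowerSeries.coeff v g ^ p := by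
    intro v
    rw [← MvPowerSeries.map_frobenius_expand p hp0, MvPowerSeries.coeff_map,
      MvPowerSeries.coeff_expand_smul]
    rfl
  have hg2 : ∀ v, MvPowerSeries.coeff v (g ^ p) ≠ 0 → ∃ v', v = p • v' := by
    intro v hv
    have hd : ∀ l, p ∣ v l := by
      intro l
      by_contra hl
      refine hv ?_
      rw [← MvPowerSeries.map_frobenius_expand p hp0, MvPowerSeries.coeff_map,
        MvPowerSeries.coeff_expand_of_not_dvd p hp0 g hl, map_zero]
    refine ⟨Finsupp.equivFunOnFinite.symm fun l => v l / p, ?_⟩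
    ext l
    simp [Nat.mul_div_cancel' (hd l)]
  ext m
  rw [coeff_cartierSection, MvPowerSeries.coeff_mul, MvPowerSeries.coeff_mul, map_sum]
  set ι : (Fin n →₀ ℕ) × (Fin n →₀ ℕ) → (Fin n →₀ ℕ) × (Fin n →₀ ℕ) :=
    fun y => (p • y.1 + r, p • y.2) with hι
  have hsmul : ∀ u v : Fin n →₀ ℕ, p • u = p • v → u = v := by
    intro u v huv
    ext l
    have := DFunLike.congr_fun huv l
    simpa [hp0] using this
  have hιinj : Function.Injective ι := by
    rintro ⟨a, b⟩ ⟨c, d⟩ hy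
    simp only [hι, Prod.mk.injEq, add_left_inj] at hy
    rw [hsmul _ _ hy.1, hsmul _ _ hy.2]
  have h1 : ∑ y ∈ Finset.HasAntidiagonal.antidiagonal m,
      MvPowerSeries.coeff y.1 (cartierSection φ p r h) * MvPowerSeries.coeff y.2 g =
      ∑ x ∈ (Finset.HasAntidiagonal.antidiagonal m).image ι,
        φ (MvPowerSeries.coeff x.1 h * MvPowerSeries.coeff x.2 (g ^ p)) := by
    rw [Finset.sum_image fun x _ y _ hxy => hιinj hxy]
    refine Finset.sum_congr rfl fun y _ => ?_
    simp only [hι]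
    rw [hg1, hφ, coeff_cartierSection]
  rw [h1]
  symm
  refine Finset.sum_subset ?_ ?_
  · intro x hx
    obtain ⟨y, hy, rfl⟩ := Finset.mem_image.1 hx
    rw [Finset.HasAntidiagonal.mem_antidiagonal] at hy ⊢
    simp only [hι]
    rw [← hy, smul_add]
    abel
  · rintro ⟨u, v⟩ hx hnot
    by_contra hne
    have hv : MvPowerSeries.coeff v (g ^ p) ≠ 0 := by
      intro h0
      exact hne (by simp [h0])
    obtain ⟨v, rfl⟩ := hg2 v hv
    rw [Finset.HasAntidiagonal.mem_antidiagonal] at hx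
    have hle : v ≤ m := by
      intro l
      have h2 := DFunLike.congr_fun hx l
      simp only [Finsupp.add_apply, Finsupp.smul_apply, smul_eq_mul] at h2
      have h3 := hr l
      have h4 : p * v l < p * (m l + 1) := by rw [mul_add, mul_one]; omega
      exact Nat.lt_succ_iff.1 (Nat.lt_of_mul_lt_mul_left h4)
    refine hnot (Finset.mem_image.2 ⟨(m - v, v), ?_, ?_⟩)
    · rw [Finset.HasAntidiagonal.mem_antidiagonal]
      exact tsub_add_cancel_of_le hle
    · simp only [hι, Prod.mk.injEq, and_true]
      have h5 : p • m = p • (m - v) + p • v := by rw [← smul_add, tsub_add_cancel_of_le hle]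
      rw [h5] at hx
      refine add_right_cancel (b := p • v) ?_
      rw [hx]
      abel

/-- A power series that is algebraic over `k(t)` is separable over `k(t)`. -/
theorem eval₂_derivative_ne_zero (p : ℕ) [hp : Fact p.Prime] [CharP k p] {f : Series k n}
    {B : (Poly k n)[X]} (hB : Irreducible B)
    (hf : B.eval₂ MvPolynomial.coeToMvPowerSeries.ringHom f = 0) :
    (derivative B).eval₂ MvPolynomial.coeToMvPowerSeries.ringHom f ≠ 0 := by
  have hinj : Function.Injective ((seriesEmb k n).comp
      (MvPolynomial.coeToMvPowerSeries.ringHom : Poly k n →+* Series k n)) :=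
    seriesEmb_injective.comp (MvPolynomial.coe_injective (Fin n) k)
  have hmin : ∀ P : (Poly k n)[X], P ≠ 0 → P.natDegree < B.natDegree →
      P.eval₂ MvPolynomial.coeToMvPowerSeries.ringHom f ≠ 0 := by
    intro P hP hdeg h0
    refine eval₂_ne_zero_of_natDegree_lt hinj (x := seriesEmb k n f) hB ?_ hP hdeg ?_
    · rw [← hom_eval₂, hf, map_zero]
    · rw [← hom_eval₂, h0, map_zero]
  have hdeg0 : B.natDegree ≠ 0 := by
    intro h0
    rw [natDegree_eq_zero] at h0
    obtain ⟨b, rfl⟩ := h0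
    rw [eval₂_C] at hf
    refine hB.ne_zero ?_
    rw [MvPolynomial.coe_injective (Fin n) k (a₁ := b) (a₂ := 0) (by simpa using hf), map_zero]
  by_cases hd : derivative B = 0
  -- Here `B = B₁(y^p)`. Applying a section operator to `B₁(f^p) = 0` gives `P(f) = 0` with `deg P ≤
  -- deg B₁ < deg B`, contradicting minimality.
  · exfalso
    have : CharP (Poly k n) p := inferInstance
    have hexp := expand_contract p hd hp.out.ne_zero
    set B₁ := contract p B with hB₁
    have hB₁0 : B₁ ≠ 0 := by
      intro h0
      rw [h0, map_zero] at hexp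
      exact hB.ne_zero hexp.symm
    obtain ⟨i₀, j₀, hc⟩ := exists_coeff_coeff_ne_zero hB₁0
    obtain ⟨φ, hφ, hφc⟩ := exists_frobenius_semilinear_ne_zero p hc
    -- The residue class of a nonzero coefficient, on which `φ` was chosen nonzero: this makes `P ≠
    -- 0`.
    set r : Fin n →₀ ℕ := Finsupp.equivFunOnFinite.symm fun l => i₀ l % p with hr
    set q : Fin n →₀ ℕ := Finsupp.equivFunOnFinite.symm fun l => i₀ l / p with hq
    have hi₀ : p • q + r = i₀ := by
      ext l
      simp [hr, hq, Nat.div_add_mod]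
    have hfin : {x : (Fin n →₀ ℕ) × ℕ |
        φ (MvPolynomial.coeff (p • x.1 + r) (B₁.coeff x.2)) ≠ 0}.Finite := by
      refine ((finite_setOf_coeff_ne_zero B₁).preimage
        (f := fun x : (Fin n →₀ ℕ) × ℕ => (p • x.1 + r, x.2)) ?_).subset ?_
      · rintro ⟨a, b⟩ _ ⟨c, d⟩ _ h
        simp only [Prod.mk.injEq, add_left_inj] at h
        refine Prod.ext ?_ h.2
        ext l
        have := DFunLike.congr_fun h.1 l
        simpa [hp.out.ne_zero] using this
      · intro x hx h0
        exact hx (by rw [h0, map_zero])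
    obtain ⟨P, hP⟩ := exists_mvPolynomial_polynomial_coeff
      (fun m j => φ (MvPolynomial.coeff (p • m + r) (B₁.coeff j))) hfin
    have hP0 : P ≠ 0 := by
      rintro rfl
      have := hP q j₀
      rw [hi₀] at this
      exact hφc (by simpa using this.symm)
    have hPcoeff : ∀ j, (MvPolynomial.coeToMvPowerSeries.ringHom (P.coeff j) : Series k n) =
        cartierSection φ p r (MvPolynomial.coeToMvPowerSeries.ringHom (B₁.coeff j)) := by
      intro j
      ext m
      rw [coeff_cartierSection]
      simp [hP]
    have hPdeg : P.natDegree ≤ B₁.natDegree := by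
      rw [natDegree_le_iff_coeff_eq_zero]
      intro j hj
      ext m
      rw [hP, coeff_eq_zero_of_natDegree_lt hj]
      simp
    refine hmin P hP0 ?_ ?_
    · rw [← hexp, natDegree_expand]
      have hpos : 0 < B₁.natDegree := by
        rw [← hexp, natDegree_expand] at hdeg0
        exact Nat.pos_of_ne_zero (left_ne_zero_of_mul hdeg0)
      have := hp.out.one_lt
      nlinarith
    · rw [← hexp, expand_eq_comp_X_pow, eval₂_comp, eval₂_X_pow,
        eval₂_eq_sum_range' _ (Nat.lt_succ_self _)] at hf
      rw [eval₂_eq_sum_range' _ (Nat.lt_succ_of_le hPdeg)]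
      have := congrArg (cartierSection φ p r) hf
      rw [map_sum, map_zero] at this
      rw [← this]
      refine Finset.sum_congr rfl fun j _ => ?_
      rw [hPcoeff, ← pow_mul, mul_comm p j, pow_mul,
        cartierSection_mul_pow p hφ (fun l => by simpa [hr] using Nat.mod_lt _ hp.out.pos)]
  · exact hmin _ hd (natDegree_derivative_lt hdeg0)

end Separability

/-! ### Newton polytopes of products and powers. -/

section Newton

open Polynomial

variable {k : Type*} [Field k] {n : ℕ}

theorem natPoint_add (i i' : Fin n → ℕ) (j j' : ℕ) :
    natPoint (i + i') (j + j') = natPoint i j + natPoint i' j' := by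
  ext <;> simp [natPoint]

theorem coeff_coeff_mul (B Q : (Poly k n)[X]) (i : Fin n →₀ ℕ) (j : ℕ) :
    MvPolynomial.coeff i ((B * Q).coeff j) =
      ∑ x ∈ Finset.HasAntidiagonal.antidiagonal j, ∑ y ∈ Finset.HasAntidiagonal.antidiagonal i,
        MvPolynomial.coeff y.1 (B.coeff x.1) * MvPolynomial.coeff y.2 (Q.coeff x.2) := by
  classical
  rw [coeff_mul, MvPolynomial.coeff_sum]
  exact Finset.sum_congr rfl fun x _ => MvPolynomial.coeff_mul _ _ _

theorem coeff_coeff_mul_ne_zero {B Q : (Poly k n)[X]} {b q : (Fin n →₀ ℕ) × ℕ}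
    (hb : MvPolynomial.coeff b.1 (B.coeff b.2) ≠ 0) (hq : MvPolynomial.coeff q.1 (Q.coeff q.2) ≠ 0)
    (huniq : ∀ x y : (Fin n →₀ ℕ) × ℕ, MvPolynomial.coeff x.1 (B.coeff x.2) ≠ 0 →
      MvPolynomial.coeff y.1 (Q.coeff y.2) ≠ 0 → x + y = b + q → x = b ∧ y = q) :
    MvPolynomial.coeff (b.1 + q.1) ((B * Q).coeff (b.2 + q.2)) ≠ 0 := by
  have hzero : ∀ (x : ℕ × ℕ) (y : (Fin n →₀ ℕ) × (Fin n →₀ ℕ)),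
      x.1 + x.2 = b.2 + q.2 → y.1 + y.2 = b.1 + q.1 →
      MvPolynomial.coeff y.1 (B.coeff x.1) * MvPolynomial.coeff y.2 (Q.coeff x.2) ≠ 0 →
      x = (b.2, q.2) ∧ y = (b.1, q.1) := by
    intro x y hx hy hne
    obtain ⟨h1, h2⟩ := huniq (y.1, x.1) (y.2, x.2)
      (left_ne_zero_of_mul hne) (right_ne_zero_of_mul hne) (Prod.ext hy hx)
    rw [← h1, ← h2]
    exact ⟨rfl, rfl⟩
  rw [coeff_coeff_mul, Finset.sum_eq_single_of_mem (b.2, q.2)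
    (Finset.HasAntidiagonal.mem_antidiagonal.2 rfl), Finset.sum_eq_single_of_mem (b.1, q.1)
    (Finset.HasAntidiagonal.mem_antidiagonal.2 rfl)]
  · exact mul_ne_zero hb hq
  · intro y hy hne
    rw [Finset.HasAntidiagonal.mem_antidiagonal] at hy
    by_contra h0
    exact hne (hzero _ y rfl hy h0).2
  · intro x hx hne
    rw [Finset.HasAntidiagonal.mem_antidiagonal] at hx
    refine Finset.sum_eq_zero fun y hy => ?_
    rw [Finset.HasAntidiagonal.mem_antidiagonal] at hy
    by_contra h0
    exact hne (hzero x y hx hy h0).1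

theorem natPoint_mem_newtonPolytope {A : (Poly k n)[X]} {i : Fin n →₀ ℕ} {j : ℕ}
    (h : MvPolynomial.coeff i (A.coeff j) ≠ 0) : natPoint i j ∈ newtonPolytope A :=
  subset_convexHull ℝ _ ⟨i, j, h, rfl⟩

theorem isCompact_newtonPolytope (A : (Poly k n)[X]) : IsCompact (newtonPolytope A) := by
  refine Set.Finite.isCompact_convexHull ℝ ?_
  refine ((finite_setOf_coeff_ne_zero A).image fun x => natPoint x.1 x.2).subset ?_
  rintro _ ⟨i, j, h, rfl⟩
  exact ⟨(i, j), h, rfl⟩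

/-- One inclusion of Ostrowski's theorem `NP(BQ) = NP(B) + NP(Q)`. -/
theorem natPoint_add_mem_newtonPolytope_mul {B Q : (Poly k n)[X]} {i i' : Fin n →₀ ℕ} {j j' : ℕ}
    (hB : MvPolynomial.coeff i (B.coeff j) ≠ 0) (hQ : MvPolynomial.coeff i' (Q.coeff j') ≠ 0) :
    natPoint i j + natPoint i' j' ∈ newtonPolytope (B * Q) := by
  classical
  by_contra hnot
  -- A functional smaller at the point than on the whole polytope. Among the terms of `B` and `Q`
  -- that minimise it, some pair has a sum attained only once; that term survives in `B * Q`, and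
  -- the functional is too small there.
  obtain ⟨f, u, hu, hf⟩ := geometric_hahn_banach_point_closed (convex_convexHull ℝ _)
    (isCompact_newtonPolytope (B * Q)).isClosed hnot
  set w : (Fin n →₀ ℕ) × ℕ → ℝ := fun x => f (natPoint x.1 x.2) with hw
  have hwadd : ∀ x y, w (x + y) = w x + w y := by
    intro x y
    rw [hw]
    simp only [Prod.fst_add, Prod.snd_add, Finsupp.coe_add, natPoint_add, map_add]
  set sB := (finite_setOf_coeff_ne_zero B).toFinset with hsB
  set sQ := (finite_setOf_coeff_ne_zero Q).toFinset with hsQ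
  obtain ⟨b, hb, hbmin⟩ := sB.exists_min_image w ⟨(i, j), by simpa [hsB] using hB⟩
  obtain ⟨q, hq, hqmin⟩ := sQ.exists_min_image w ⟨(i', j'), by simpa [hsQ] using hQ⟩
  obtain ⟨b₀, hb₀, q₀, hq₀, huniq⟩ := UniqueSums.uniqueAdd_of_nonempty
    (A := sB.filter fun x => w x = w b) (B := sQ.filter fun x => w x = w q)
    ⟨b, by simp [hb]⟩ ⟨q, by simp [hq]⟩
  rw [Finset.mem_filter] at hb₀ hq₀
  have huniq' : ∀ x y, x ∈ sB → y ∈ sQ → x + y = b₀ + q₀ → x = b₀ ∧ y = q₀ := by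
    intro x y hx hy hxy
    have h1 := hbmin x hx
    have h2 := hqmin y hy
    have h3 : w x + w y = w b + w q := by rw [← hwadd, hxy, hwadd, hb₀.2, hq₀.2]
    refine huniq ?_ ?_ hxy
    · exact Finset.mem_filter.2 ⟨hx, by linarith⟩
    · exact Finset.mem_filter.2 ⟨hy, by linarith⟩
  have hmemB : ∀ x, x ∈ sB ↔ MvPolynomial.coeff x.1 (B.coeff x.2) ≠ 0 := by simp [hsB]
  have hmemQ : ∀ x, x ∈ sQ ↔ MvPolynomial.coeff x.1 (Q.coeff x.2) ≠ 0 := by simp [hsQ]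
  have hcoeff := coeff_coeff_mul_ne_zero ((hmemB b₀).1 hb₀.1) ((hmemQ q₀).1 hq₀.1)
    fun x y hx hy => huniq' x y ((hmemB x).2 hx) ((hmemQ y).2 hy)
  have h1 := hf _ (natPoint_mem_newtonPolytope hcoeff)
  have h2 := hwadd b₀ q₀
  have h3 : w (b₀ + q₀) = f (natPoint (b₀.1 + q₀.1 : Fin n →₀ ℕ) (b₀.2 + q₀.2)) := rfl
  rw [← h3, h2, hb₀.2, hq₀.2] at h1
  have h4 := hbmin (i, j) ((hmemB _).2 hB)
  have h5 := hqmin (i', j') ((hmemQ _).2 hQ)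
  rw [map_add] at hu
  have h6 : w (i, j) = f (natPoint i j) := rfl
  have h7 : w (i', j') = f (natPoint i' j') := rfl
  linarith

theorem natPoint_mem_smul_newtonPolytope_pow {B : (Poly k n)[X]} (hB : B ≠ 0) (q : ℕ)
    {i : Fin n →₀ ℕ} {j : ℕ} (h : MvPolynomial.coeff i ((B ^ q).coeff j) ≠ 0) :
    natPoint i j ∈ (q : ℝ) • newtonPolytope B := by
  classical
  induction q generalizing i j with
  | zero =>
    -- The dilate by `0` is `{0}` only for a nonempty polytope, hence the assumption `B ≠ 0`.
    obtain ⟨i', j', h'⟩ := exists_coeff_coeff_ne_zero hB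
    refine ⟨_, natPoint_mem_newtonPolytope h', ?_⟩
    rw [pow_zero, coeff_one] at h
    by_cases hj : j = 0
    · rw [if_pos hj, MvPolynomial.coeff_one] at h
      by_cases hi : 0 = i
      · subst hj hi
        ext <;> simp [natPoint]
      · exact absurd (if_neg hi) h
    · rw [if_neg hj] at h
      exact absurd (MvPolynomial.coeff_zero _) h
  | succ q ih =>
    rw [pow_succ, coeff_coeff_mul] at h
    obtain ⟨x, hx, h⟩ := Finset.exists_ne_zero_of_sum_ne_zero h
    obtain ⟨y, hy, h⟩ := Finset.exists_ne_zero_of_sum_ne_zero h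
    rw [Finset.HasAntidiagonal.mem_antidiagonal] at hx hy
    have hconv : Convex ℝ (newtonPolytope B) := convex_convexHull ℝ _
    rw [Nat.cast_succ, hconv.add_smul (Nat.cast_nonneg q) zero_le_one, one_smul, ← hx, ← hy, Finsupp.coe_add, natPoint_add]
    exact Set.add_mem_add (ih (left_ne_zero_of_mul h))
      (natPoint_mem_newtonPolytope (right_ne_zero_of_mul h))

end Newton

/-! ### Lattice points modulo `G`, and finiteness of the classes. -/

section Lattice

variable {n : ℕ}

/-- The point of `ℝⁿ` with coordinates `i ∈ ℤⁿ`. -/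
def intPoint (i : Fin n → ℤ) : Fin n → ℝ := fun l => (i l : ℝ)

theorem intPoint_add (i j : Fin n → ℤ) : intPoint (i + j) = intPoint i + intPoint j := by
  funext l; simp [intPoint]

theorem intPoint_sub (i j : Fin n → ℤ) : intPoint (i - j) = intPoint i - intPoint j := by
  funext l; simp [intPoint]

theorem intPoint_mem_realSpan {G : AddSubgroup (Fin n → ℤ)} {i : Fin n → ℤ} (hi : i ∈ G) :
    intPoint i ∈ realSpan G := Submodule.subset_span ⟨i, hi, rfl⟩

/-- The quotient `ℤⁿ / G` is finitely generated and torsion-free, hence free, so a vector outside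
`G` is detected by an integral linear form killing `G`. Its real extension kills `realSpan G`. -/
theorem mem_of_intPoint_mem_realSpan {G : AddSubgroup (Fin n → ℤ)}
    (hG : IsAddTorsionFree ((Fin n → ℤ) ⧸ G)) {i : Fin n → ℤ} (hi : intPoint i ∈ realSpan G) :
    i ∈ G := by
  classical
  by_contra hnot
  have hfin : Module.Finite ℤ ((Fin n → ℤ) ⧸ G) :=
    Module.Finite.of_surjective (QuotientAddGroup.mk' G).toIntLinearMap
      (QuotientAddGroup.mk'_surjective G)
  have hfree : Module.Free ℤ ((Fin n → ℤ) ⧸ G) := Module.free_of_finite_type_torsion_free'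
  have hne : (QuotientAddGroup.mk' G i) ≠ 0 := by
    rwa [Ne, QuotientAddGroup.mk'_apply, QuotientAddGroup.eq_zero_iff]
  have h := (Module.forall_dual_apply_eq_zero_iff ℤ (QuotientAddGroup.mk' G i)).not.2 hne
  push Not at h
  obtain ⟨φ, hφ⟩ := h
  set ψ : (Fin n → ℤ) →ₗ[ℤ] ℤ := φ.comp (QuotientAddGroup.mk' G).toIntLinearMap with hψ
  set Ψ : (Fin n → ℝ) →ₗ[ℝ] ℝ :=
    ∑ l, ((ψ (Pi.single l 1) : ℤ) : ℝ) • LinearMap.proj l with hΨ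
  have hΨψ : ∀ j : Fin n → ℤ, Ψ (intPoint j) = ((ψ j : ℤ) : ℝ) := by
    intro j
    have h1 : j = ∑ l, j l • (Pi.single l 1 : Fin n → ℤ) := by
      funext m; simp [Finset.sum_apply, Pi.single_apply]
    conv_rhs => rw [h1, map_sum]
    simp only [map_smul, smul_eq_mul, Int.cast_sum, Int.cast_mul, hΨ, LinearMap.sum_apply,
      LinearMap.smul_apply, LinearMap.proj_apply, intPoint]
    exact Finset.sum_congr rfl fun l _ => mul_comm _ _
  have hker : realSpan G ≤ LinearMap.ker Ψ := by
    refine Submodule.span_le.2 ?_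
    rintro _ ⟨j, hj, rfl⟩
    rw [SetLike.mem_coe, LinearMap.mem_ker]
    refine (hΨψ j).trans ?_
    have : (QuotientAddGroup.mk' G j) = 0 := by
      rwa [QuotientAddGroup.mk'_apply, QuotientAddGroup.eq_zero_iff]
    simp only [hψ, LinearMap.comp_apply, AddMonoidHom.coe_toIntLinearMap, this, map_zero,
      Int.cast_zero]
  have h2 := LinearMap.mem_ker.1 (hker hi)
  rw [hΨψ] at h2
  exact hφ (by exact_mod_cast h2)

/-- Every element of the real span of a lattice is a lattice element plus a bounded remainder. -/
theorem exists_bound_realSpan (G : AddSubgroup (Fin n → ℤ)) :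
    ∃ K : ℝ, ∀ g ∈ realSpan G, ∃ γ ∈ G, ‖g - intPoint γ‖ ≤ K := by
  classical
  obtain ⟨s, hs, hspan⟩ := (Submodule.fg_span_iff_fg_span_finset_subset (R := ℝ)
    {x : Fin n → ℝ | ∃ i ∈ G, x = fun l => (i l : ℝ)}).1 (IsNoetherian.noetherian _)
  have hs' : ∀ x ∈ s, ∃ i ∈ G, x = intPoint i := fun x hx => hs hx
  choose! ρ hρG hρ using hs'
  refine ⟨∑ x ∈ s, ‖x‖, fun g hg => ?_⟩
  rw [realSpan, hspan, Submodule.mem_span_finset] at hg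
  obtain ⟨c, -, rfl⟩ := hg
  refine ⟨∑ x ∈ s, ⌊c x⌋ • ρ x, sum_mem fun x hx => G.zsmul_mem (hρG x hx) _, ?_⟩
  have h1 : intPoint (∑ x ∈ s, ⌊c x⌋ • ρ x) = ∑ x ∈ s, (⌊c x⌋ : ℝ) • x := by
    funext l
    simp only [intPoint, Finset.sum_apply, Pi.smul_apply, smul_eq_mul, Int.cast_sum, Int.cast_mul]
    refine Finset.sum_congr rfl fun x hx => ?_
    congr 1
    exact (congrFun (hρ x hx) l).symm
  rw [h1, ← Finset.sum_sub_distrib]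
  refine (norm_sum_le _ _).trans (Finset.sum_le_sum fun x _ => ?_)
  rw [← sub_smul, norm_smul, Int.self_sub_floor, Real.norm_of_nonneg (Int.fract_nonneg _)]
  exact mul_le_of_le_one_left (norm_nonneg _) (Int.fract_lt_one _).le

theorem mem_convexC_iff {k : Type*} [Field k] {G : AddSubgroup (Fin n → ℤ)}
    {A : Polynomial (Poly k n)} {x : Fin n → ℝ} {h : ℝ} :
    (x, h) ∈ convexC G A ↔ ∃ z ∈ newtonPolytope A, ∃ g ∈ realSpan G, ∃ θ : ℝ, 0 ≤ θ ∧ θ < 1 ∧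
      x = z.1 + g ∧ h = z.2 - θ := by
  constructor
  · rintro ⟨z, hz, ⟨g, t⟩, ⟨hg, ht⟩, heq⟩
    obtain ⟨h1, h2⟩ := Prod.ext_iff.1 heq
    refine ⟨z, hz, g, hg, -t, by linarith [ht.2], by linarith [ht.1], h1.symm, ?_⟩
    rw [sub_neg_eq_add]
    exact h2.symm
  · rintro ⟨z, hz, g, hg, θ, h0, h1, rfl, rfl⟩
    exact ⟨z, hz, (g, -θ), ⟨hg, by simpa using h1, by simpa using h0⟩, rfl⟩

/-- Translation by `G` brings every point into a bounded box. The translated point may leave `ℕⁿ`,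
so the box consists of integral vectors. -/
theorem classesC_finite {k : Type*} [Field k] (G : AddSubgroup (Fin n → ℤ))
    (A : Polynomial (Poly k n)) : (classesC G A).Finite := by
  obtain ⟨M, hM⟩ := (isCompact_newtonPolytope A).isBounded.exists_norm_le
  obtain ⟨K, hK⟩ := exists_bound_realSpan G
  set N : ℤ := ⌈M + K⌉ with hN
  have hfin : ((Set.Icc (fun _ => -N) (fun _ => N) : Set (Fin n → ℤ)) ×ˢ
      (Set.Iic ⌊M⌋₊ : Set ℕ)).Finite := (Set.finite_Icc _ _).prod (Set.finite_Iic _)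
  refine (hfin.image fun x => projG G (intPoint x.1, (x.2 : ℝ))).subset ?_
  rintro _ ⟨_, ⟨hC, i, j, rfl⟩, rfl⟩
  obtain ⟨z, hz, g, hg, θ, h0, h1, hx, hh⟩ := mem_convexC_iff.1 hC
  obtain ⟨γ, hγ, hle⟩ := hK g hg
  have hzM := hM z hz
  set i' : Fin n → ℤ := (fun l => (i l : ℤ)) - γ with hi'
  have hpt : intPoint i' = z.1 + (g - intPoint γ) := by
    rw [hi', intPoint_sub, add_sub, ← hx]
    rfl
  refine ⟨(i', j), ⟨?_, ?_⟩, ?_⟩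
  · have hb : ∀ l, |((i' l : ℤ) : ℝ)| ≤ N := by
      intro l
      have h2 : ‖intPoint i'‖ ≤ M + K := by
        rw [hpt]
        exact (norm_add_le _ _).trans (add_le_add ((norm_fst_le z).trans hzM) hle)
      exact ((norm_le_pi_norm (intPoint i') l).trans h2).trans (Int.le_ceil _)
    constructor <;> intro l
    · have := (abs_le.1 (hb l)).1
      exact_mod_cast this
    · have := (abs_le.1 (hb l)).2
      exact_mod_cast this
  · rw [Set.mem_Iic]
    refine Nat.le_floor ?_
    rw [hh]
    have := (le_abs_self z.2).trans ((norm_snd_le z).trans hzM)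
    linarith
  · refine Prod.ext ?_ rfl
    refine (Submodule.Quotient.eq _).2 ?_
    have : intPoint i' - (natPoint i j).1 = -intPoint γ := by
      rw [hi', intPoint_sub]
      funext l
      simp [intPoint, natPoint]
    change intPoint i' - (natPoint i j).1 ∈ realSpan G
    rw [this]
    exact neg_mem (intPoint_mem_realSpan hγ)

end Lattice

/-! ### Setting variables to zero in an algebraic equation. -/

section Specialisation

open Polynomial

variable {k : Type*} [Field k] {n : ℕ}

open Classical in
/-- The ring homomorphism `k[[t]] → k[[t]]` that sends `t_l` to `0` for `l ∉ S`. -/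
noncomputable def restrictVars (S : Set (Fin n)) : Series k n →+* Series k n where
  toFun f := fun i => if ∀ l ∉ S, i l = 0 then MvPowerSeries.coeff i f else 0
  map_one' := by
    ext i
    change (if _ then _ else _) = _
    split_ifs with h
    · rfl
    · rw [MvPowerSeries.coeff_one, if_neg]
      rintro rfl
      exact h fun _ _ => rfl
  map_zero' := by
    ext i
    change (if _ then _ else _) = _
    simp
  map_add' f g := by
    ext i
    refine Eq.trans ?_ (map_add (MvPowerSeries.coeff i) _ _).symm
    change (if ∀ l ∉ S, i l = 0 then MvPowerSeries.coeff i (f + g) else 0) =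
      (if ∀ l ∉ S, i l = 0 then MvPowerSeries.coeff i f else 0) +
      (if ∀ l ∉ S, i l = 0 then MvPowerSeries.coeff i g else 0)
    split_ifs <;> simp
  map_mul' f g := by
    ext i
    refine Eq.trans ?_ (MvPowerSeries.coeff_mul i _ _).symm
    change (if ∀ l ∉ S, i l = 0 then MvPowerSeries.coeff i (f * g) else 0) =
      ∑ x ∈ Finset.HasAntidiagonal.antidiagonal i,
        (if ∀ l ∉ S, x.1 l = 0 then MvPowerSeries.coeff x.1 f else 0) *
        (if ∀ l ∉ S, x.2 l = 0 then MvPowerSeries.coeff x.2 g else 0)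
    split_ifs with h
    · rw [MvPowerSeries.coeff_mul]
      refine Finset.sum_congr rfl fun x hx => ?_
      rw [Finset.HasAntidiagonal.mem_antidiagonal] at hx
      have h' : ∀ l ∉ S, x.1 l + x.2 l = 0 := fun l hl => by
        rw [← Finsupp.add_apply, hx, h l hl]
      rw [if_pos fun l hl => (Nat.add_eq_zero_iff.1 (h' l hl)).1,
        if_pos fun l hl => (Nat.add_eq_zero_iff.1 (h' l hl)).2]
    · symm
      refine Finset.sum_eq_zero fun x hx => ?_
      rw [Finset.HasAntidiagonal.mem_antidiagonal] at hx
      by_cases h1 : ∀ l ∉ S, x.1 l = 0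
      · have h3 : ¬ ∀ l ∉ S, x.2 l = 0 := fun h2 => h fun l hl => by
          rw [← hx, Finsupp.add_apply, h1 l hl, h2 l hl]
        rw [if_neg h3, mul_zero]
      · rw [if_neg h1, zero_mul]

theorem coeff_restrictVars_of_mem {S : Set (Fin n)} {i : Fin n →₀ ℕ} (h : ∀ l ∉ S, i l = 0)
    (f : Series k n) : MvPowerSeries.coeff i (restrictVars S f) = MvPowerSeries.coeff i f :=
  if_pos h

theorem coeff_restrictVars_of_notMem {S : Set (Fin n)} {i : Fin n →₀ ℕ}
    (h : ¬ ∀ l ∉ S, i l = 0) (f : Series k n) :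
    MvPowerSeries.coeff i (restrictVars S f) = 0 := if_neg h

/-- Plain substitution could kill `A`. Instead `A₁` is the coefficient in `A` of a monomial `t^e` in
the variables outside `S`, with `e` of least total degree among those that occur. In the coefficient
of `t^(i+e)` in `A(f)`, with `i` supported on `S`, minimality leaves only terms of `f^j` without
variables outside `S`. -/
theorem exists_eval₂_restrictVars_eq_zero (S : Set (Fin n)) {A : (Poly k n)[X]} (hA : A ≠ 0)
    {f : Series k n} (hf : A.eval₂ MvPolynomial.coeToMvPowerSeries.ringHom f = 0) :
    ∃ A₁ : (Poly k n)[X], A₁ ≠ 0 ∧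
      A₁.eval₂ MvPolynomial.coeToMvPowerSeries.ringHom (restrictVars S f) = 0 ∧
      ∃ e : Fin n →₀ ℕ, ∀ i j, MvPolynomial.coeff i (A₁.coeff j) ≠ 0 →
        (∀ l ∉ S, i l = 0) ∧ MvPolynomial.coeff (i + e) (A.coeff j) ≠ 0 := by
  classical
  set wt : (Fin n →₀ ℕ) → ℕ := fun i => ∑ l ∈ Finset.univ.filter (· ∉ S), i l with hwt
  obtain ⟨x, hx, hmin⟩ := (finite_setOf_coeff_ne_zero A).toFinset.exists_min_image
    (fun x => wt x.1) (by
      obtain ⟨i, j, h⟩ := exists_coeff_coeff_ne_zero hA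
      exact ⟨(i, j), by simpa using h⟩)
  rw [Set.Finite.mem_toFinset] at hx
  set e : Fin n →₀ ℕ := x.1.filter (· ∉ S) with he
  have heS : ∀ l ∈ S, e l = 0 := fun l hl => Finsupp.filter_apply_neg _ _ (by simpa using hl)
  have heS' : ∀ l ∉ S, e l = x.1 l := fun l hl => Finsupp.filter_apply_pos _ _ hl
  have hemin : ∀ m j, MvPolynomial.coeff m (A.coeff j) ≠ 0 → (∀ l ∉ S, m l ≤ e l) → e ≤ m := by
    intro m j hm hle
    have h1 : wt x.1 ≤ wt m := hmin (m, j) (by simpa using hm)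
    have h2 : ∀ l ∈ Finset.univ.filter (· ∉ S), m l ≤ x.1 l := fun l hl => by
      have hl' := (Finset.mem_filter.1 hl).2
      rw [← heS' l hl']
      exact hle l hl'
    have h3 := (Finset.sum_eq_sum_iff_of_le h2).1 (le_antisymm (Finset.sum_le_sum h2) h1)
    intro l
    by_cases hl : l ∈ S
    · rw [heS l hl]; exact Nat.zero_le _
    · rw [heS' l hl, h3 l (by simpa using hl)]
  have hfin : {x : (Fin n →₀ ℕ) × ℕ | (if ∀ l ∉ S, x.1 l = 0 then
      MvPolynomial.coeff (x.1 + e) (A.coeff x.2) else 0) ≠ 0}.Finite := by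
    refine ((finite_setOf_coeff_ne_zero A).preimage
      (f := fun x : (Fin n →₀ ℕ) × ℕ => (x.1 + e, x.2)) ?_).subset ?_
    · rintro ⟨a, b⟩ _ ⟨c, d⟩ _ h
      simpa using h
    · intro x hx h0
      refine hx ?_
      simp only at h0
      rw [h0, ite_self]
  obtain ⟨A₁, hA₁⟩ := exists_mvPolynomial_polynomial_coeff (fun i j =>
    if ∀ l ∉ S, i l = 0 then MvPolynomial.coeff (i + e) (A.coeff j) else 0) hfin
  have hpos : ∀ {i : Fin n →₀ ℕ}, (∀ l ∉ S, i l = 0) → ∀ j,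
      MvPolynomial.coeff i (A₁.coeff j) = MvPolynomial.coeff (i + e) (A.coeff j) := fun h j => by
    rw [hA₁, if_pos h]
  refine ⟨A₁, ?_, ?_, e, ?_⟩
  · rintro rfl
    have h1 := hpos (i := x.1.filter (· ∈ S)) (fun l hl => Finsupp.filter_apply_neg _ _ hl) x.2
    rw [he, Finsupp.filter_add_filter_not] at h1
    exact hx (by simpa using h1.symm)
  · set M := max A.natDegree A₁.natDegree + 1 with hM
    rw [eval₂_eq_sum_range' _ (show A₁.natDegree < M by omega)]
    rw [eval₂_eq_sum_range' _ (show A.natDegree < M by omega)] at hf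
    have h1 : ∀ j, (MvPolynomial.coeToMvPowerSeries.ringHom (A₁.coeff j) : Series k n) =
        restrictVars S (MvPolynomial.coeToMvPowerSeries.ringHom (A₁.coeff j)) := by
      intro j
      ext i
      by_cases h : ∀ l ∉ S, i l = 0
      · rw [coeff_restrictVars_of_mem h]
      · rw [coeff_restrictVars_of_notMem h]
        simp [hA₁, h]
    have h2 : ∀ j ∈ Finset.range M, (MvPolynomial.coeToMvPowerSeries.ringHom (A₁.coeff j) *
        restrictVars S f ^ j : Series k n) =
        restrictVars S (MvPolynomial.coeToMvPowerSeries.ringHom (A₁.coeff j) * f ^ j) := by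
      intro j _
      rw [map_mul, map_pow, ← h1]
    rw [Finset.sum_congr rfl h2, ← map_sum]
    ext i
    by_cases h : ∀ l ∉ S, i l = 0
    · rw [coeff_restrictVars_of_mem h]
      have h3 := congrArg (MvPowerSeries.coeff (i + e)) hf
      rw [map_zero, map_sum] at h3
      rw [map_zero, map_sum, ← h3]
      refine Finset.sum_congr rfl fun j _ => ?_
      rw [MvPowerSeries.coeff_mul, MvPowerSeries.coeff_mul]
      set ι : (Fin n →₀ ℕ) × (Fin n →₀ ℕ) → (Fin n →₀ ℕ) × (Fin n →₀ ℕ) :=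
        fun y => (y.1 + e, y.2) with hι
      have hιinj : Function.Injective ι := by
        rintro ⟨a, b⟩ ⟨c, d⟩ hy
        simpa [hι] using hy
      have h4 : ∑ y ∈ Finset.HasAntidiagonal.antidiagonal i,
          MvPowerSeries.coeff y.1
            (MvPolynomial.coeToMvPowerSeries.ringHom (A₁.coeff j) : Series k n) *
            MvPowerSeries.coeff y.2 (f ^ j) =
          ∑ y ∈ (Finset.HasAntidiagonal.antidiagonal i).image ι,
            MvPowerSeries.coeff y.1
            (MvPolynomial.coeToMvPowerSeries.ringHom (A.coeff j) : Series k n) *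
            MvPowerSeries.coeff y.2 (f ^ j) := by
        rw [Finset.sum_image fun x _ y _ hxy => hιinj hxy]
        refine Finset.sum_congr rfl fun y hy => ?_
        rw [Finset.HasAntidiagonal.mem_antidiagonal] at hy
        have hy' : ∀ l ∉ S, y.1 l = 0 := fun l hl => by
          have := DFunLike.congr_fun hy l
          rw [Finsupp.add_apply, h l hl] at this
          omega
        simp [hι, hpos hy']
      rw [h4]
      refine Finset.sum_subset ?_ ?_
      · intro _ hy'
        obtain ⟨y, hy, rfl⟩ := Finset.mem_image.1 hy'
        clear hy'
        rw [Finset.HasAntidiagonal.mem_antidiagonal] at hy ⊢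
        simp only [hι]
        rw [← hy]
        abel
      · rintro ⟨u, v⟩ hy hnot
        rw [Finset.HasAntidiagonal.mem_antidiagonal] at hy
        by_contra hne
        have hu : MvPolynomial.coeff u (A.coeff j) ≠ 0 := by
          simpa using left_ne_zero_of_mul hne
        have hle : e ≤ u := hemin u j hu fun l hl => by
          have := DFunLike.congr_fun hy l
          simp only [Finsupp.add_apply, h l hl] at this
          omega
        refine hnot (Finset.mem_image.2 ⟨(u - e, v), ?_, ?_⟩)
        · rw [Finset.HasAntidiagonal.mem_antidiagonal]
          refine add_right_cancel (b := e) ?_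
          rw [← hy]
          simp only
          rw [add_right_comm, tsub_add_cancel_of_le hle]
        · simp only [hι, tsub_add_cancel_of_le hle]
    · rw [coeff_restrictVars_of_notMem h, map_zero]
  · intro i j hij
    by_cases h : ∀ l ∉ S, i l = 0
    · exact ⟨h, by rwa [hpos h] at hij⟩
    · rw [hA₁, if_neg h] at hij
      exact absurd rfl hij

end Specialisation

/-! ### The nonnegative vectors of `G`, and stability of the convex set. -/

section Cone

variable {n : ℕ}

/-- The set of indices `l` such that some vector of `G ∩ ℕⁿ` has a positive `l`-th coordinate. -/
def positiveIndices (G : AddSubgroup (Fin n → ℤ)) : Set (Fin n) :=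
  {l | ∃ w ∈ G, (∀ m, 0 ≤ w m) ∧ 0 < w l}

theorem eq_zero_of_notMem_positiveIndices {G : AddSubgroup (Fin n → ℤ)} {w : Fin n → ℤ}
    (hw : w ∈ G) (h0 : ∀ m, 0 ≤ w m) {l : Fin n} (hl : l ∉ positiveIndices G) : w l = 0 := by
  by_contra h
  exact hl ⟨w, hw, h0, lt_of_le_of_ne (h0 l) (Ne.symm h)⟩

theorem exists_pos_on_positiveIndices (G : AddSubgroup (Fin n → ℤ)) :
    ∃ w ∈ G, (∀ m, 0 ≤ w m) ∧ ∀ l ∈ positiveIndices G, 0 < w l := by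
  classical
  have h : ∀ l : Fin n, ∃ w ∈ G, (∀ m, 0 ≤ w m) ∧ (l ∈ positiveIndices G → 0 < w l) := by
    intro l
    by_cases hl : l ∈ positiveIndices G
    · obtain ⟨w, hw, h0, h1⟩ := hl
      exact ⟨w, hw, h0, fun _ => h1⟩
    · exact ⟨0, G.zero_mem, fun _ => le_rfl, fun h => absurd h hl⟩
  choose w hw h0 h1 using h
  refine ⟨∑ l, w l, sum_mem fun l _ => hw l, fun m => ?_, fun l hl => ?_⟩
  · rw [Finset.sum_apply]
    exact Finset.sum_nonneg fun l _ => h0 l m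
  · rw [Finset.sum_apply]
    exact (h1 l hl).trans_le
      (Finset.single_le_sum (f := fun l' => w l' l) (fun l' _ => h0 l' l) (Finset.mem_univ l))

/-- Every integral vector supported on `positiveIndices G` is congruent to a natural one
modulo `G`. -/
theorem exists_nat_add_mem {G : AddSubgroup (Fin n → ℤ)} {i : Fin n → ℤ}
    (hi : ∀ l ∉ positiveIndices G, i l = 0) :
    ∃ (i' : Fin n →₀ ℕ) (γ : Fin n → ℤ), γ ∈ G ∧ (∀ l ∉ positiveIndices G, γ l = 0) ∧
      (∀ l ∉ positiveIndices G, i' l = 0) ∧ i = γ + expInt i' := by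
  obtain ⟨w, hw, h0, h1⟩ := exists_pos_on_positiveIndices G
  -- On `positiveIndices G` the integer `w l` is at least `1`, so adding `L • w` makes every
  -- coordinate nonnegative.
  set L : ℤ := ∑ l, |i l| with hL
  have hle : ∀ l, |i l| ≤ L := fun l =>
    Finset.single_le_sum (f := fun l => |i l|) (fun l _ => abs_nonneg _) (Finset.mem_univ l)
  have hw0 : ∀ l ∉ positiveIndices G, w l = 0 := fun l hl =>
    eq_zero_of_notMem_positiveIndices hw h0 hl
  have hnn : ∀ l, 0 ≤ i l + L * w l := by
    intro l
    by_cases hl : l ∈ positiveIndices G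
    · have h2 := h1 l hl
      have h3 := hle l
      have h4 := neg_abs_le (i l)
      have h5 := abs_nonneg (i l)
      nlinarith
    · rw [hi l hl, hw0 l hl, mul_zero, add_zero]
  refine ⟨Finsupp.equivFunOnFinite.symm fun l => (i l + L * w l).toNat, -(L • w),
    G.neg_mem (G.zsmul_mem hw _), fun l hl => ?_, fun l hl => ?_, ?_⟩
  · simp [hw0 l hl]
  · simp [hw0 l hl, hi l hl]
  · funext l
    simp [expInt, Int.toNat_of_nonneg (hnn l)]

/-- The vectors of `G` that are supported on `positiveIndices G`. -/
def lexSubgroup (G : AddSubgroup (Fin n → ℤ)) : AddSubgroup (Lex (Fin n → ℤ)) where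
  carrier := {m | ofLex m ∈ G ∧ ∀ l ∉ positiveIndices G, ofLex m l = 0}
  zero_mem' := ⟨G.zero_mem, fun _ _ => rfl⟩
  add_mem' := fun {a b} ha hb => ⟨G.add_mem ha.1 hb.1, fun l hl => by
    rw [ofLex_add, Pi.add_apply, ha.2 l hl, hb.2 l hl, add_zero]⟩
  neg_mem' := fun {a} ha => ⟨G.neg_mem ha.1, fun l hl => by
    rw [ofLex_neg, Pi.neg_apply, ha.2 l hl, neg_zero]⟩

theorem mem_lexSubgroup_of_nsmul_mem {G : AddSubgroup (Fin n → ℤ)}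
    (hG : IsAddTorsionFree ((Fin n → ℤ) ⧸ G)) {p : ℕ} (hp : p ≠ 0) (m : Lex (Fin n → ℤ))
    (h : p • m ∈ lexSubgroup G) : m ∈ lexSubgroup G := by
  obtain ⟨h1, h2⟩ := h
  refine ⟨?_, fun l hl => ?_⟩
  · have h3 : p • (QuotientAddGroup.mk (ofLex m) : (Fin n → ℤ) ⧸ G) = 0 := by
      rw [← QuotientAddGroup.mk_nsmul, QuotientAddGroup.eq_zero_iff]
      exact h1
    rw [← QuotientAddGroup.eq_zero_iff]
    exact (nsmul_eq_zero_iff_right hp).1 h3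
  · have h3 : p • ofLex m l = 0 := h2 l hl
    simpa [hp] using h3

/-- An exponent in `G ∩ ℕⁿ` is automatically supported on `positiveIndices G`, so discarding the
other variables loses no term of the diagonal. -/
theorem hahnRestrict_seriesEmb_restrictVars {k : Type*} [Field k] (G : AddSubgroup (Fin n → ℤ))
    (f : Series k n) :
    hahnRestrict (lexSubgroup G : Set (Lex (Fin n → ℤ)))
      (seriesEmb k n (restrictVars (positiveIndices G) f)) =
      seriesEmb k n (gDiagonal k G f : Series k n) := by
  classical
  ext m
  by_cases hm : m ∈ Set.range expLex
  · obtain ⟨i, rfl⟩ := hm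
    rw [seriesEmb_coeff_expLex, gDiagonal_coeff]
    by_cases hi : expInt i ∈ G
    · have h0 : ∀ l ∉ positiveIndices G, expInt i l = 0 := fun l hl =>
        eq_zero_of_notMem_positiveIndices hi (fun m => Int.natCast_nonneg _) hl
      rw [if_pos hi, hahnRestrict_coeff_of_mem (show expLex i ∈ lexSubgroup G from ⟨hi, h0⟩),
        seriesEmb_coeff_expLex, coeff_restrictVars_of_mem]
      intro l hl
      have := h0 l hl
      simpa [expInt] using this
    · rw [if_neg hi, hahnRestrict_coeff_of_notMem]
      exact fun h => hi h.1
  · rw [seriesEmb_coeff_of_notMem _ hm]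
    by_cases h : m ∈ lexSubgroup G
    · rw [hahnRestrict_coeff_of_mem h, seriesEmb_coeff_of_notMem _ hm]
    · exact hahnRestrict_coeff_of_notMem h _

variable {k : Type*} [Field k]

theorem seriesEmb_coe (b : Poly k n) :
    seriesEmb k n (MvPolynomial.coeToMvPowerSeries.ringHom b) =
      ∑ u ∈ b.support, HahnSeries.single (expLex u) (MvPolynomial.coeff u b) := by
  conv_lhs => rw [b.as_sum, map_sum, map_sum]
  refine Finset.sum_congr rfl fun u _ => ?_
  rw [← seriesEmb_monomial, MvPolynomial.coeToMvPowerSeries.ringHom_apply,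
    MvPolynomial.coe_monomial]

/-- The new polytope point is the barycentre `(z₀ + (p-1) z₁) / p`, and the height defect `θ`
becomes `(θ + p - 1) / p`. This stays below `1` exactly when `θ` does, whence the half-open interval
in `convexC`. -/
theorem mem_convexC_of_mul {G : AddSubgroup (Fin n → ℤ)} {B : Polynomial (Poly k n)} {p : ℝ}
    (hp : 1 ≤ p) {x u γ x' : Fin n → ℝ} {h r h' : ℝ} (hx : (x, h) ∈ convexC G B)
    (hu : (u, r) ∈ (p - 1) • newtonPolytope B) (hγ : γ ∈ realSpan G)
    (h1 : x + u = γ + p • x') (h2 : h + r = p * h' + (p - 1)) : (x', h') ∈ convexC G B := by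
  obtain ⟨z₀, hz₀, g, hg, θ, hθ0, hθ1, rfl, rfl⟩ := mem_convexC_iff.1 hx
  obtain ⟨z₁, hz₁, hz⟩ := hu
  have hu1 : (p - 1) • z₁.1 = u := congrArg Prod.fst hz
  have hu2 : (p - 1) * z₁.2 = r := congrArg Prod.snd hz
  have hp0 : 0 < p := by linarith
  have hconv : Convex ℝ (newtonPolytope B) := convex_convexHull ℝ _
  refine mem_convexC_iff.2 ⟨p⁻¹ • z₀ + (p⁻¹ * (p - 1)) • z₁, hconv hz₀ hz₁ (by positivity)
    (mul_nonneg (by positivity) (by linarith)) (by field_simp; ring),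
    p⁻¹ • (g - γ), Submodule.smul_mem _ _ (sub_mem hg hγ), p⁻¹ * (θ + (p - 1)), ?_, ?_, ?_, ?_⟩
  · exact mul_nonneg (by positivity) (by linarith)
  · rw [inv_mul_lt_iff₀ hp0]; linarith
  · have h3 : x' = p⁻¹ • (z₀.1 + g + u - γ) := by
      rw [h1, add_sub_cancel_left, smul_smul, inv_mul_cancel₀ hp0.ne', one_smul]
    rw [h3, ← hu1]
    simp only [Prod.smul_fst, Prod.fst_add, smul_add, smul_sub, mul_smul]
    abel
  · have h3 : h' = p⁻¹ * (z₀.2 - θ + r - (p - 1)) := by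
      rw [h2]; field_simp; ring
    rw [h3, ← hu2]
    simp only [Prod.smul_snd, Prod.snd_add, smul_eq_mul]
    ring

theorem add_mem_convexC {G : AddSubgroup (Fin n → ℤ)} {A B : Polynomial (Poly k n)}
    {y : (Fin n → ℝ) × ℝ}
    (hy : ∀ i j, MvPolynomial.coeff i (B.coeff j) ≠ 0 → natPoint i j + y ∈ newtonPolytope A)
    {x : (Fin n → ℝ) × ℝ} (hx : x ∈ convexC G B) : x + y ∈ convexC G A := by
  obtain ⟨z, hz, t, ht, rfl⟩ := hx
  have hsub : newtonPolytope B ⊆ (fun z => z + y) ⁻¹' newtonPolytope A := by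
    refine convexHull_min ?_ ((convex_convexHull ℝ _).translate_preimage_left y)
    rintro _ ⟨i, j, h, rfl⟩
    exact hy i j h
  exact ⟨z + y, hsub hz, t, ht, by simp only; abel⟩

end Cone

/-! ### The span of the diagonals of `t^i F^j / D`. -/

section Span

variable {k : Type*} [Field k] {n : ℕ}

noncomputable instance algebraRatFunGLexSeries (G : AddSubgroup (Fin n → ℤ)) :
    Algebra (ratFunG k G) (LexSeries k n) :=
  ((ratFunToLex k n).comp (algebraMap (ratFunG k G) (RatFun k n))).toAlgebra

theorem ratFunG_smul_def (G : AddSubgroup (Fin n → ℤ)) (c : ratFunG k G) (y : LexSeries k n) :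
    c • y = ratFunToLex k n c * y := rfl

variable {G : AddSubgroup (Fin n → ℤ)} {W : Submodule (ratFunG k G) (LexSeries k n)}

theorem single_mul_mem {γ : Lex (Fin n → ℤ)} (hγ : ofLex γ ∈ G) (a : k) {y : LexSeries k n}
    (hy : y ∈ W) : HahnSeries.single γ a * y ∈ W := by
  have h1 : (HahnSeries.single γ a : LexSeries k n) = ratFunToLex k n
      (algebraMap k (ratFunG k G) a * ⟨laurentMonomial k (ofLex γ),
        IntermediateField.subset_adjoin k _ ⟨_, hγ, rfl⟩⟩ : ratFunG k G) := by
    rw [MulMemClass.coe_mul, map_mul]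
    change _ = ratFunToLex k n (algebraMap k (RatFun k n) a) *
      ratFunToLex k n (laurentMonomial k (ofLex γ))
    rw [ratFunToLex_algebraMap_const, ratFunToLex_laurentMonomial, HahnSeries.single_mul_single,
      zero_add, mul_one, toLex_ofLex]
  rw [h1, ← ratFunG_smul_def]
  exact W.smul_mem _ hy

/-- The diagonal of `t^i F^j / D`. -/
noncomputable def diagonalQuotient (G : AddSubgroup (Fin n → ℤ)) (F D : LexSeries k n)
    (i : Lex (Fin n → ℤ)) (j : ℕ) : LexSeries k n :=
  hahnRestrict (lexSubgroup G : Set (Lex (Fin n → ℤ))) (HahnSeries.single i 1 * (F ^ j / D))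

theorem diagonalQuotient_add {F D : LexSeries k n} {γ : Lex (Fin n → ℤ)}
    (hγ : γ ∈ lexSubgroup G) (i : Lex (Fin n → ℤ)) (j : ℕ) :
    diagonalQuotient G F D (γ + i) j = HahnSeries.single γ 1 * diagonalQuotient G F D i j := by
  rw [diagonalQuotient, diagonalQuotient, ← hahnRestrict_single_mul _ hγ, ← mul_assoc,
    HahnSeries.single_mul_single, one_mul]

/-- If a submodule contains the diagonals of `t^i F^j / D` for the natural `(i, j)` in the convex
set of `B`, it contains them for integral `i`. -/
theorem diagonalQuotient_mem {F D : LexSeries k n} {B : Polynomial (Poly k n)}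
    (hW : ∀ (i : Fin n →₀ ℕ) (j : ℕ), (∀ l ∉ positiveIndices G, i l = 0) →
      natPoint i j ∈ convexC G B → diagonalQuotient G F D (expLex i) j ∈ W)
    {i : Fin n → ℤ} {j : ℕ} (hi : ∀ l ∉ positiveIndices G, i l = 0)
    (hC : (intPoint i, (j : ℝ)) ∈ convexC G B) : diagonalQuotient G F D (toLex i) j ∈ W := by
  obtain ⟨i', γ, hγ, hγ0, hi', rfl⟩ := exists_nat_add_mem hi
  have h1 : toLex (γ + expInt i') = toLex γ + expLex i' := rfl
  rw [h1, diagonalQuotient_add (show toLex γ ∈ lexSubgroup G from ⟨hγ, hγ0⟩)]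
  refine single_mul_mem hγ _ (hW i' j hi' ?_)
  obtain ⟨z, hz, g, hg, θ, h0, h1, hx, hh⟩ := mem_convexC_iff.1 hC
  refine mem_convexC_iff.2 ⟨z, hz, g - intPoint γ, sub_mem hg (intPoint_mem_realSpan hγ), θ, h0,
    h1, ?_, hh⟩
  rw [add_sub, ← hx, intPoint_add, add_sub_cancel_left]
  funext l
  simp [intPoint, expInt]

open Polynomial in
/-- The diagonals of `t^i f^j / B'(f)` lie in the span of the `p`-th powers of such diagonals. -/
theorem diagonalQuotient_mem_span_pow (p : ℕ) [hp : Fact p.Prime] [CharP k p]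
    (hG : IsAddTorsionFree ((Fin n → ℤ) ⧸ G)) {B : (Poly k n)[X]} (hB0 : B ≠ 0) {f : Series k n}
    (hf : B.eval₂ MvPolynomial.coeToMvPowerSeries.ringHom f = 0)
    (hf' : (derivative B).eval₂ MvPolynomial.coeToMvPowerSeries.ringHom f ≠ 0)
    {F D : LexSeries k n} (hF : F = seriesEmb k n f) (hD : D = seriesEmb k n
      ((derivative B).eval₂ MvPolynomial.coeToMvPowerSeries.ringHom f))
    (hBS : ∀ i j, MvPolynomial.coeff i (B.coeff j) ≠ 0 → ∀ l ∉ positiveIndices G, i l = 0)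
    {ι : Type*} {x : ι → LexSeries k n}
    (hx : ∀ (i : Fin n →₀ ℕ) (j : ℕ), (∀ l ∉ positiveIndices G, i l = 0) →
      natPoint i j ∈ convexC G B →
        diagonalQuotient G F D (expLex i) j ∈ Submodule.span (ratFunG k G) (Set.range x))
    {i : Fin n →₀ ℕ} {j : ℕ} (hi : ∀ l ∉ positiveIndices G, i l = 0)
    (hC : natPoint i j ∈ convexC G B) :
    diagonalQuotient G F D (expLex i) j ∈
      Submodule.span (ratFunG k G) (Set.range fun c => x c ^ p) := by
  have hp1 := hp.out.one_lt
  have hD0 : D ≠ 0 := by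
    rw [hD]
    exact fun h => hf' (seriesEmb_injective (h.trans (map_zero _).symm))
  set φ : Poly k n →+* LexSeries k n :=
    (seriesEmb k n).comp MvPolynomial.coeToMvPowerSeries.ringHom with hφ
  have hBF : (B.map φ).eval F = 0 := by
    rw [eval_map, hF, hφ, ← hom_eval₂, hf, map_zero]
  have hBD : (derivative (B.map φ)).eval F = D := by
    rw [derivative_map, eval_map, hF, hφ, ← hom_eval₂, hD]
  have hBSpow : ∀ q i j, MvPolynomial.coeff i ((B ^ q).coeff j) ≠ 0 →
      ∀ l ∉ positiveIndices G, i l = 0 := by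
    intro q i j h l hl
    obtain ⟨z, hz, heq⟩ := natPoint_mem_smul_newtonPolytope_pow hB0 q h
    have hz0 : z.1 l = 0 := by
      have hsub : newtonPolytope B ⊆ {z | z.1 l = 0} := by
        refine convexHull_min ?_ ?_
        · rintro _ ⟨i, j, h, rfl⟩
          exact Nat.cast_eq_zero.2 (hBS i j h l hl)
        · exact convex_hyperplane (f := fun z : (Fin n → ℝ) × ℝ => z.1 l)
            ⟨fun _ _ => rfl, fun _ _ => rfl⟩ 0
      exact hsub hz
    have h1 := congrFun (congrArg Prod.fst heq) l
    have h2 : (q : ℝ) * z.1 l = (i l : ℝ) := h1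
    rw [hz0, mul_zero] at h2
    exact_mod_cast h2.symm
  have hres := cartierEval_mul_pow p F (X ^ j) (B.map φ) hBF
  rw [hBD, eval_pow, eval_X, cartierEval_apply] at hres
  -- Write `F^j / D = F^j D^(p-1) / D^p` and apply the residue formula with `P = y^j`. If `m + 1 = p
  -- q`, then `F^(m+1-p)` is the `p`-th power of `F^(q-1)`.
  have hquot : F ^ j / D = ∑ m ∈ (X ^ j * B.map φ ^ (p - 1)).support, if p ∣ m + 1 then
      (X ^ j * B.map φ ^ (p - 1)).coeff m * (F ^ ((m + 1) / p - 1) / D) ^ p else 0 := by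
    have h1 : F ^ j / D = (F ^ j * D ^ (p - 1)) / D ^ p := by
      rw [← Nat.sub_add_cancel hp1.le, pow_succ D (p - 1), Nat.add_sub_cancel]
      field_simp
    rw [h1, ← hres, Finset.sum_div]
    refine Finset.sum_congr rfl fun m _ => ?_
    split_ifs with hd
    · obtain ⟨q, hq⟩ := hd
      rw [hq, Nat.mul_div_cancel_left _ hp.out.pos, div_pow, ← pow_mul, mul_div_assoc,
        Nat.sub_mul, one_mul, mul_comm q p]
    · rw [zero_div]
  rw [diagonalQuotient, hquot, Finset.mul_sum, map_sum]
  refine sum_mem fun m _ => ?_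
  split_ifs with hd
  swap
  · rw [mul_zero, map_zero]; exact zero_mem _
  obtain ⟨q, hq⟩ := hd
  have hq0 : q ≠ 0 := by rintro rfl; simp at hq
  rw [hq, Nat.mul_div_cancel_left _ hp.out.pos, ← Polynomial.map_pow, coeff_X_pow_mul']
  split_ifs with hjm
  swap
  · rw [zero_mul, mul_zero, map_zero]; exact zero_mem _
  rw [coeff_map, hφ, RingHom.comp_apply, seriesEmb_coe, Finset.sum_mul, Finset.mul_sum, map_sum]
  refine sum_mem fun u hu => ?_
  rw [MvPolynomial.mem_support_iff] at hu
  set a := MvPolynomial.coeff u ((B ^ (p - 1)).coeff (m - j)) with ha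
  have hsplit : HahnSeries.single (expLex i) (1 : k) * (HahnSeries.single (expLex u) a *
      (F ^ (q - 1) / D) ^ p) = HahnSeries.single 0 a *
        (HahnSeries.single (expLex i + expLex u) 1 * (F ^ (q - 1) / D) ^ p) := by
    rw [← mul_assoc, ← mul_assoc, HahnSeries.single_mul_single, HahnSeries.single_mul_single,
      one_mul, mul_one, zero_add]
  rw [hsplit, hahnRestrict_single_mul _ (zero_mem _)]
  refine single_mul_mem G.zero_mem a ?_
  rcases hahnRestrict_single_mul_pow_char p (lexSubgroup G)
    (fun m hm => mem_lexSubgroup_of_nsmul_mem hG hp.out.ne_zero m hm)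
    (expLex i + expLex u) (F ^ (q - 1) / D) with h0 | ⟨γ, hγ, i', hi', h0⟩
  · rw [h0]; exact zero_mem _
  rw [h0]
  refine single_mul_mem hγ.1 1 (pow_mem_span_pow p ?_)
  have hu0 := hBSpow (p - 1) u (m - j) hu
  have hcoord : ∀ l, (i l : ℤ) + u l = ofLex γ l + p * ofLex i' l := fun l => by
    have h1 := congrFun (congrArg ofLex hi') l
    have h2 : (i l : ℤ) + u l = ofLex γ l + p • ofLex i' l := h1
    rwa [nsmul_eq_mul] at h2
  refine diagonalQuotient_mem hx (i := ofLex i') (j := q - 1) ?_ ?_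
  · intro l hl
    have h1 := hcoord l
    rw [hi l hl, hu0 l hl, hγ.2 l hl] at h1
    have hpz : (p : ℤ) ≠ 0 := by exact_mod_cast hp.out.ne_zero
    have h2 : (p : ℤ) * ofLex i' l = 0 := by simpa only [Nat.cast_zero, zero_add] using h1.symm
    exact (mul_eq_zero.1 h2).resolve_left hpz
  · have hpow := natPoint_mem_smul_newtonPolytope_pow hB0 (p - 1) hu
    rw [Nat.cast_sub hp1.le, Nat.cast_one] at hpow
    refine mem_convexC_of_mul (p := p) (by exact_mod_cast hp1.le) hC hpow
      (intPoint_mem_realSpan hγ.1) ?_ ?_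
    · funext l
      have h1 := hcoord l
      have h2 : (i l : ℝ) + u l = ((ofLex γ l : ℤ) : ℝ) + p * ((ofLex i' l : ℤ) : ℝ) := by
        exact_mod_cast h1
      simpa [intPoint] using h2
    -- Heights: `j + (m - j) = m = p (q - 1) + (p - 1)`.
    · rw [Nat.cast_sub hjm, Nat.cast_sub (Nat.one_le_iff_ne_zero.2 hq0), Nat.cast_one]
      have h1 : (m : ℝ) + 1 = p * q := by exact_mod_cast hq
      linarith

open Polynomial in
-- Write `F = F B'(F) / D = ∑ m b_m F^m / D`, where `b_m` are the coefficients of `B`. Each monomial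
-- `t^u y^m` of `B` gives a point `(u, m)` of `NP(B)`, hence of the convex set.
theorem hahnRestrict_mem_span {B : (Poly k n)[X]} {f : Series k n}
    (hf' : (derivative B).eval₂ MvPolynomial.coeToMvPowerSeries.ringHom f ≠ 0)
    {F D : LexSeries k n} (hF : F = seriesEmb k n f) (hD : D = seriesEmb k n
      ((derivative B).eval₂ MvPolynomial.coeToMvPowerSeries.ringHom f))
    (hBS : ∀ i j, MvPolynomial.coeff i (B.coeff j) ≠ 0 → ∀ l ∉ positiveIndices G, i l = 0)
    (hW : ∀ (i : Fin n →₀ ℕ) (j : ℕ), (∀ l ∉ positiveIndices G, i l = 0) →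
      natPoint i j ∈ convexC G B → diagonalQuotient G F D (expLex i) j ∈ W) :
    hahnRestrict (lexSubgroup G : Set (Lex (Fin n → ℤ))) F ∈ W := by
  have hD0 : D ≠ 0 := by
    rw [hD]
    exact fun h => hf' (seriesEmb_injective (h.trans (map_zero _).symm))
  set φ : Poly k n →+* LexSeries k n :=
    (seriesEmb k n).comp MvPolynomial.coeToMvPowerSeries.ringHom with hφ
  have hBD : (derivative (B.map φ)).eval F = D := by
    rw [derivative_map, eval_map, hF, hφ, ← hom_eval₂, hD]
  have hquot : F = ∑ m ∈ (B.map φ).support, m • ((B.map φ).coeff m * (F ^ m / D)) := by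
    have h1 : F = F * D / D := by field_simp
    have h2 := hBD
    rw [derivative_eval, Polynomial.sum] at h2
    refine h1.trans ?_
    conv_lhs => rw [← h2, Finset.mul_sum, h2, Finset.sum_div]
    refine Finset.sum_congr rfl fun m _ => ?_
    rw [nsmul_eq_mul]
    rcases m with _ | m
    · simp
    · rw [Nat.add_sub_cancel, pow_succ]
      ring
  rw [hquot, map_sum]
  refine sum_mem fun m _ => ?_
  rw [map_nsmul]
  refine W.nsmul_mem ?_ m
  rw [coeff_map, hφ, RingHom.comp_apply, seriesEmb_coe, Finset.sum_mul, map_sum]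
  refine sum_mem fun u hu => ?_
  rw [MvPolynomial.mem_support_iff] at hu
  set a := MvPolynomial.coeff u (B.coeff m) with ha
  have hsplit : HahnSeries.single (expLex u) a * (F ^ m / D) = HahnSeries.single 0 a *
      (HahnSeries.single (expLex u) 1 * (F ^ m / D)) := by
    rw [← mul_assoc, HahnSeries.single_mul_single, mul_one, zero_add]
  rw [hsplit, hahnRestrict_single_mul _ (zero_mem _)]
  refine single_mul_mem G.zero_mem a (hW u m (hBS u m hu) ?_)
  exact mem_convexC_iff.2 ⟨_, natPoint_mem_newtonPolytope hu, 0, zero_mem _, 0, le_rfl, one_pos,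
    (add_zero _).symm, (sub_zero _).symm⟩

/-- Representatives of the classes: a family indexed by `classesC G A` whose span contains all
diagonals of `t^i F^j / D`, where `(i, j)` is natural in the convex set of `B`. -/
theorem exists_family_diagonalQuotient (hG : IsAddTorsionFree ((Fin n → ℤ) ⧸ G))
    {A B : Polynomial (Poly k n)} (F D : LexSeries k n) {e : Fin n →₀ ℕ} {d : ℕ}
    (hBA : ∀ i j, MvPolynomial.coeff i (B.coeff j) ≠ 0 →
      natPoint i j + natPoint e d ∈ newtonPolytope A) :
    ∃ x : classesC G A → LexSeries k n,
      (∀ c, x c = 0 ∨ ∃ (i : Fin n →₀ ℕ) (j : ℕ), (∀ l ∉ positiveIndices G, i l = 0) ∧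
        natPoint i j ∈ convexC G B ∧ x c = diagonalQuotient G F D (expLex i) j) ∧
      ∀ (i : Fin n →₀ ℕ) (j : ℕ), (∀ l ∉ positiveIndices G, i l = 0) →
        natPoint i j ∈ convexC G B →
        diagonalQuotient G F D (expLex i) j ∈ Submodule.span (ratFunG k G) (Set.range x) := by
  classical
  let P : classesC G A → (Fin n →₀ ℕ) × ℕ → Prop := fun c y =>
    (∀ l ∉ positiveIndices G, y.1 l = 0) ∧ natPoint y.1 y.2 ∈ convexC G B ∧
      projG G (natPoint y.1 y.2 + natPoint e d) = c
  -- Classes of `A` not reached by the translated convex set of `B` receive `0`, so the family is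
  -- indexed by all of `classesC G A`.
  refine ⟨fun c => if h : ∃ y, P c y then
    diagonalQuotient G F D (expLex h.choose.1) h.choose.2 else 0, fun c => ?_, fun i j hi hC => ?_⟩
  · by_cases h : ∃ y, P c y
    · exact Or.inr ⟨_, _, h.choose_spec.1, h.choose_spec.2.1, dif_pos h⟩
    · exact Or.inl (dif_neg h)
  · set c : classesC G A := ⟨projG G (natPoint i j + natPoint e d),
      _, ⟨add_mem_convexC hBA hC, i + e, j + d, (natPoint_add _ _ _ _).symm⟩, rfl⟩ with hc
    have h : ∃ y, P c y := ⟨(i, j), hi, hC, rfl⟩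
    have hspec := h.choose_spec
    obtain ⟨hi₁, -, hcl⟩ := hspec
    have hmem : diagonalQuotient G F D (expLex h.choose.1) h.choose.2 ∈
        Submodule.span (ratFunG k G) (Set.range fun c => if h : ∃ y, P c y then
          diagonalQuotient G F D (expLex h.choose.1) h.choose.2 else 0) :=
      Submodule.subset_span ⟨c, dif_pos h⟩
    set y := h.choose with hy
    have hcl' : projG G (natPoint y.1 y.2) = projG G (natPoint i j) := by
      have h1 := hcl.trans (show (c : _ × ℝ) = projG G (natPoint i j + natPoint e d) from rfl)
      rw [map_add, map_add] at h1
      exact add_right_cancel h1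
    obtain ⟨hcl1, hcl2⟩ := Prod.ext_iff.1 hcl'
    have hj : y.2 = j := Nat.cast_injective (R := ℝ) hcl2
    have hGmem : expInt i - expInt y.1 ∈ G := by
      refine mem_of_intPoint_mem_realSpan hG ?_
      have h1 := (Submodule.Quotient.eq _).1 hcl1.symm
      rw [intPoint_sub]
      exact h1
    have hγ : expLex i - expLex y.1 ∈ lexSubgroup G := by
      refine ⟨hGmem, fun l hl => ?_⟩
      have h1 := hi l hl
      have h2 := hi₁ l hl
      change (i l : ℤ) - (y.1 l : ℤ) = 0
      rw [h1, h2, sub_self]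
    have h2 := diagonalQuotient_add (F := F) (D := D) hγ (expLex y.1) j
    rw [sub_add_cancel] at h2
    rw [h2, ← hj]
    exact single_mul_mem hγ.1 1 hmem

end Span

end OreDiagonal

/-! ### The theorem. -/

theorem theorem6 (p : ℕ) [Fact p.Prime] (k : Type*) [Field k] [CharP k p] (n : ℕ)
    (G : AddSubgroup (Fin n → ℤ)) (hG : IsAddTorsionFree ((Fin n → ℤ) ⧸ G))
    (A : Polynomial (MvPolynomial (Fin n) k)) (hA : A ≠ 0)
    (f : MvPowerSeries (Fin n) k)
    (hf : A.eval₂ MvPolynomial.coeToMvPowerSeries.ringHom f = 0) :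
    (OreDiagonal.classesC G A).Finite ∧
    ∃ c : Fin ((OreDiagonal.classesC G A).ncard + 1) → OreDiagonal.ratFunG k G, (∃ j, c j ≠ 0) ∧
      ∑ j, OreDiagonal.ratFunEmb k n (c j) *
        (algebraMap (MvPowerSeries (Fin n) k) (FractionRing (MvPowerSeries (Fin n) k))
          (OreDiagonal.gDiagonal k G f)) ^ (p ^ (j : ℕ)) = 0 := by
  classical
  have hfin := OreDiagonal.classesC_finite G A
  refine ⟨hfin, ?_⟩
  obtain ⟨A₁, hA₁, hf₁, e, he⟩ := OreDiagonal.exists_eval₂_restrictVars_eq_zero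
    (OreDiagonal.positiveIndices G) hA hf
  set f₀ := OreDiagonal.restrictVars (OreDiagonal.positiveIndices G) f with hf₀
  obtain ⟨B, Q, rfl, hB, hfB⟩ := OreDiagonal.exists_irreducible_factor_of_map_eq_zero
    ((OreDiagonal.seriesEmb k n).comp
      (Polynomial.eval₂RingHom MvPolynomial.coeToMvPowerSeries.ringHom f₀)) hA₁
    (by rw [RingHom.comp_apply, Polynomial.coe_eval₂RingHom, hf₁, map_zero])
  rw [RingHom.comp_apply, Polynomial.coe_eval₂RingHom] at hfB
  replace hfB := OreDiagonal.seriesEmb_injective (hfB.trans (map_zero _).symm)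
  have hfB' := OreDiagonal.eval₂_derivative_ne_zero p hB hfB
  -- Any term of the cofactor `Q` translates `NP(B)` into `NP(B * Q)`; a further translation by `e`
  -- lands in `NP(A)`.
  obtain ⟨v, d, hv⟩ := OreDiagonal.exists_coeff_coeff_ne_zero (right_ne_zero_of_mul hA₁)
  have hNP : ∀ i j, MvPolynomial.coeff i (B.coeff j) ≠ 0 →
      OreDiagonal.natPoint i j + OreDiagonal.natPoint v d ∈
        OreDiagonal.newtonPolytope (B * Q) := fun i j h =>
    OreDiagonal.natPoint_add_mem_newtonPolytope_mul h hv
  have hBS : ∀ i j, MvPolynomial.coeff i (B.coeff j) ≠ 0 →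
      ∀ l ∉ OreDiagonal.positiveIndices G, i l = 0 := by
    intro i j h l hl
    have hsub : OreDiagonal.newtonPolytope (B * Q) ⊆ {z | z.1 l = 0} := by
      refine convexHull_min ?_ ?_
      · rintro _ ⟨i, j, h, rfl⟩
        exact Nat.cast_eq_zero.2 ((he i j h).1 l hl)
      · exact convex_hyperplane (f := fun z : (Fin n → ℝ) × ℝ => z.1 l)
          ⟨fun _ _ => rfl, fun _ _ => rfl⟩ 0
    have h1 : (i l : ℝ) + v l = 0 := hsub (hNP i j h)
    have h2 : i l + v l = 0 := by exact_mod_cast h1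
    omega
  have hBA : ∀ i j, MvPolynomial.coeff i (B.coeff j) ≠ 0 → OreDiagonal.natPoint i j +
      OreDiagonal.natPoint (v + e : Fin n →₀ ℕ) d ∈ OreDiagonal.newtonPolytope A := by
    intro i j h
    have hsub : OreDiagonal.newtonPolytope (B * Q) ⊆
        (fun z => z + OreDiagonal.natPoint e 0) ⁻¹' OreDiagonal.newtonPolytope A := by
      refine convexHull_min ?_ ((convex_convexHull ℝ _).translate_preimage_left _)
      rintro _ ⟨i, j, h, rfl⟩
      have h1 := OreDiagonal.natPoint_mem_newtonPolytope (he i j h).2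
      rw [Finsupp.coe_add] at h1
      change OreDiagonal.natPoint i j + OreDiagonal.natPoint e 0 ∈ OreDiagonal.newtonPolytope A
      rwa [← OreDiagonal.natPoint_add, add_zero]
    have h2 := hsub (hNP i j h)
    have h3 := OreDiagonal.natPoint_add v e d 0
    rw [add_zero] at h3
    rw [Finsupp.coe_add, h3, ← add_assoc]
    exact h2
  set F := OreDiagonal.seriesEmb k n f₀ with hF
  set D := OreDiagonal.seriesEmb k n
    ((Polynomial.derivative B).eval₂ MvPolynomial.coeToMvPowerSeries.ringHom f₀) with hD
  obtain ⟨x, hx, hspan⟩ := OreDiagonal.exists_family_diagonalQuotient hG F D hBA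
  have hw := OreDiagonal.hahnRestrict_mem_span hfB' hF hD hBS hspan
  have hxp : ∀ c, x c ∈ Submodule.span (OreDiagonal.ratFunG k G)
      (Set.range fun c => x c ^ p) := by
    intro c
    rcases hx c with h0 | ⟨i, j, hi, hC, h0⟩
    · rw [h0]; exact zero_mem _
    · rw [h0]
      exact OreDiagonal.diagonalQuotient_mem_span_pow p hG hB.ne_zero hfB hfB' hF hD hBS hspan hi hC
  have : Fintype (OreDiagonal.classesC G A) := hfin.fintype
  have hcard : Fintype.card (OreDiagonal.classesC G A) = (OreDiagonal.classesC G A).ncard := by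
    rw [← Nat.card_eq_fintype_card, Nat.card_coe_set_eq]
  have hrel := OreDiagonal.exists_sum_smul_pow_char_pow_eq_zero p hxp hw
  rw [hcard] at hrel
  obtain ⟨c, hc, hsum⟩ := hrel
  -- The relation was found among Hahn series; injectivity brings it back to `Frac(k[[t]])`.
  refine ⟨c, hc, (OreDiagonal.seriesFieldEmb k n).injective ?_⟩
  rw [map_zero, ← hsum, map_sum]
  refine Finset.sum_congr rfl fun j _ => ?_
  rw [hF, hf₀, OreDiagonal.hahnRestrict_seriesEmb_restrictVars, map_mul, map_pow,
    OreDiagonal.seriesFieldEmb_algebraMap, OreDiagonal.ratFunG_smul_def]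
  rfl
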